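/- **Setting.** Let $H=\mathbb C^3$ with the group law $(u^1,u^2,u^3)*(w^1,w^2,w^3)=(u^1+w^1,\;e^{-w^1}u^2+w^2,\;e^{w^1}u^3+w^3)$, let $\ell=\log\frac{3+\sqrt5}{2}$, $m=\frac{\sqrt5-1}{2}$, and let $\Delta\subset H$ be the discrete cocompact subgroup generated by $(\ell,0,0)$, $(2\pi i,0,0)$, $(0,-m,1)$, $(0,1,m)$, $(0,-2\pi i m,2\pi i)$, $(0,2\pi i,2\pi i m)$. Let $X=H/\Delta$ be the de Bartolomeis–Tomassini Nakamura manifold and $N=X\times S^1$, with $S^1=\mathbb R/2\pi\mathbb Z$. The right-invariant complex 1-forms $\Theta^1=dw^1$, $\Theta^2=e^{w^1}dw^2$, $\Theta^3=e^{-w^1}dw^3$ on $H$ descend to $X$. Put $g^1=\operatorname{Re}\Theta^1$, $g^2=\operatorname{Im}\Theta^1$, let $g^3=dt$ be the canonical 1-form on $S^1$, and let $\omega=\frac i2(\Theta^2\wedge\overline{\Theta}{}^2+\Theta^3\wedge\overline{\Theta}{}^3)$ and $\Omega=\Theta^2\wedge\Theta^3$. For $\alpha,\beta\in\mathbb R\setminus\{0\}$,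 $\lambda\in\mathbb C\setminus\{0\}$ and $\mu\ge1$ define 3-forms on $N$ by $$\varphi(\alpha,\beta,\lambda;\mu)=\alpha\beta\,g^{123}+\alpha\mu^6\,g^1\wedge\omega-\beta\,g^2\wedge\operatorname{Re}(\lambda\Omega)+g^3\wedge\operatorname{Im}(\lambda\Omega),\qquad \varphi(\alpha,\beta,\lambda)=\varphi(\alpha,\beta,\lambda;1).$$ A 3-form on an oriented 7-manifold is a $\mathrm G_2$ 3-form if at each point there is a correctly oriented basis $\theta^1,\dots,\theta^7$ of the cotangent space in which it equals $\theta^{123}+\theta^{145}+\theta^{167}+\theta^{246}-\theta^{257}-\theta^{347}-\theta^{356}$; its volume form is then $\theta^{1234567}$, which does not depend on the choice of basis. If $\varphi$ is a closed $\mathrm G_2$ 3-form on a closed oriented 7-manifold $M$, then $[\varphi]_+$ is the set of $\mathrm G_2$ 3-forms in the de Rham class $[\varphi]$, and the Hitchin functional is $\mathcal H:[\varphi]_+\to(0,\infty)$, $\mathcal H(\varphi')=\int_M vol_{\varphi'}$. **Theorem.** All the 3-forms $\varphi(\alpha,\beta,\lambda)$ on $N$ are closed, and the map $$(\mathbb R\setminus\{0\})^2\times(\mathbb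 C\setminus\{0\})\to H^3_{\mathrm{dR}}(N),\qquad(\alpha,\beta,\lambda)\mapsto[\varphi(\alpha,\beta,\lambda)]$$ is injective. Moreover, for each $(\alpha,\beta,\lambda)$ orient $N$ by the 7-form $\alpha\beta\,g^{123}\wedge\omega^2$. Then $\varphi(\alpha,\beta,\lambda)$ is a $\mathrm G_2$ 3-form, $\mathcal H$ takes values in $(0,\infty)$ on $[\varphi(\alpha,\beta,\lambda)]_+$, and for every $\mu\ge1$ $$\varphi(\alpha,\beta,\lambda;\mu)\in[\varphi(\alpha,\beta,\lambda)]_+,\qquad \mathcal H(\varphi(\alpha,\beta,\lambda;\mu))=\mu^4\,\mathcal H(\varphi(\alpha,\beta,\lambda)).$$ In particular, $\mathcal H$ is unbounded above on $[\varphi(\alpha,\beta,\lambda)]_+$. -/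

import Mathlib

open scoped Manifold ENNReal
open MeasureTheory

noncomputable section

namespace HitchinNakamura

/-! ### Differential forms on manifolds -/

section Forms

/-- The wedge product `θ₀ ∧ ⋯ ∧ θₖ₋₁` of real- or complex-valued covectors. -/
def wedge {V A : Type*} [AddCommGroup V] [Module ℝ V] [TopologicalSpace V]
    [NormedCommRing A] [NormedAlgebra ℝ A] {k : ℕ} (θ : Fin k → V →L[ℝ] A) : V [⋀^Fin k]→L[ℝ] A :=
  ContinuousMultilinearMap.alternatization
    ((ContinuousMultilinearMap.mkPiAlgebra ℝ (Fin k) A).compContinuousLinearMap θ)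

/-- `(θ₀ ∧ ⋯ ∧ θₖ₋₁)(v₀, …, vₖ₋₁) = det (θᵢ(vⱼ))`. -/
theorem wedge_apply {V A : Type*} [AddCommGroup V] [Module ℝ V] [TopologicalSpace V]
    [NormedCommRing A] [NormedAlgebra ℝ A] {k : ℕ} (θ : Fin k → V →L[ℝ] A) (v : Fin k → V) :
    wedge θ v = Matrix.det (Matrix.of fun i j => θ i (v j)) := by
  rw [wedge, ContinuousMultilinearMap.alternatization_apply_apply, ← Matrix.det_transpose,
    Matrix.det_apply]
  simp [Function.comp_def]

variable (E : Type*) [NormedAddCommGroup E] [NormedSpace ℝ E]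
  (M : Type*) [TopologicalSpace M] [ChartedSpace E M]

/-- A (not necessarily smooth) field of alternating `k`-forms on the tangent spaces of the
manifold `M` without boundary, modelled on the normed space `E`. -/
def Form (k : ℕ) : Type _ := (x : M) → TangentSpace 𝓘(ℝ, E) x [⋀^Fin k]→L[ℝ] ℝ

instance (k : ℕ) : AddCommGroup (Form E M k) :=
  inferInstanceAs (AddCommGroup ((x : M) → TangentSpace 𝓘(ℝ, E) x [⋀^Fin k]→L[ℝ] ℝ))

instance (k : ℕ) : Module ℝ (Form E M k) :=
  inferInstanceAs (Module ℝ ((x : M) → TangentSpace 𝓘(ℝ, E) x [⋀^Fin k]→L[ℝ] ℝ))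

variable {E M} {k : ℕ}

/-- The coordinate expression of a form in the chart `c`, i.e. its pullback along `c⁻¹`.
It is meaningful on `c.target`. -/
def inChart (ω : Form E M k) (c : OpenPartialHomeomorph M E) (y : E) : E [⋀^Fin k]→L[ℝ] ℝ :=
  (ω (c.symm y)).compContinuousLinearMap (mfderiv 𝓘(ℝ, E) 𝓘(ℝ, E) c.symm y)

/-- A form is smooth if all its coordinate expressions are. -/
def IsSmooth (ω : Form E M k) : Prop :=
  ∀ c ∈ atlas E M, ContDiffOn ℝ ((⊤ : ℕ∞) : WithTop ℕ∞) (inChart ω c) c.target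

/-- The exterior derivative of a form on a manifold, computed at `x` in the chart at `x`. -/
def extD (ω : Form E M k) : Form E M (k + 1) := fun x =>
  (extDeriv (inChart ω (chartAt E x)) (chartAt E x x)).compContinuousLinearMap
    (mfderiv 𝓘(ℝ, E) 𝓘(ℝ, E) (chartAt E x) x)

theorem inChart_add (ω η : Form E M k) (c) :
    inChart (ω + η) c = inChart ω c + inChart η c := rfl
theorem inChart_smul (r : ℝ) (ω : Form E M k) (c) :
    inChart (r • ω) c = r • inChart ω c := rfl
theorem inChart_zero (c) : inChart (0 : Form E M k) c = 0 := rfl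

theorem IsSmooth.differentiableAt {ω : Form E M k} (h : IsSmooth ω) (x : M) :
    DifferentiableAt ℝ (inChart ω (chartAt E x)) (chartAt E x x) :=
  ((h _ (chart_mem_atlas E x)).contDiffAt ((chartAt E x).open_target.mem_nhds
    (mem_chart_target E x))).differentiableAt (by simp)

theorem IsSmooth.add {ω η : Form E M k} (h : IsSmooth ω) (h' : IsSmooth η) :
    IsSmooth (ω + η) := fun c hc => (h c hc).add (h' c hc)
theorem IsSmooth.smul {ω : Form E M k} (h : IsSmooth ω) (r : ℝ) :
    IsSmooth (r • ω) := fun c hc => (h c hc).const_smul r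
theorem isSmooth_zero : IsSmooth (0 : Form E M k) := fun c _ =>
  (contDiffOn_const : ContDiffOn ℝ _ (fun _ => (0 : E [⋀^Fin k]→L[ℝ] ℝ)) c.target)

theorem extD_add {ω η : Form E M k} (h : IsSmooth ω) (h' : IsSmooth η) :
    extD (ω + η) = extD ω + extD η := by
  funext x
  simp only [extD, inChart_add, extDeriv_add (h.differentiableAt x) (h'.differentiableAt x)]
  rfl
theorem extD_smul (r : ℝ) (ω : Form E M k) : extD (r • ω) = r • extD ω := by
  funext x
  simp only [extD, inChart_smul, extDeriv_smul]
  rfl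
theorem extD_zero : extD (0 : Form E M k) = 0 := by
  simpa using extD_smul (0 : ℝ) (0 : Form E M k)

variable (E M k)
/-- The space of smooth closed `k`-forms. -/
def closedForms : Submodule ℝ (Form E M k) where
  carrier := {ω | IsSmooth ω ∧ extD ω = 0}
  zero_mem' := ⟨isSmooth_zero, extD_zero⟩
  add_mem' := fun h h' => ⟨h.1.add h'.1, by rw [extD_add h.1 h'.1, h.2, h'.2, add_zero]⟩
  smul_mem' := fun r _ h => ⟨h.1.smul r, by rw [extD_smul, h.2, smul_zero]⟩

/-- The space of exact `(k + 1)`-forms `dη`, with `η` a smooth `k`-form. -/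
def exactForms : Submodule ℝ (Form E M (k + 1)) where
  carrier := {ω | ∃ η : Form E M k, IsSmooth η ∧ extD η = ω}
  zero_mem' := ⟨0, isSmooth_zero, extD_zero⟩
  add_mem' := by
    rintro _ _ ⟨η, h, rfl⟩ ⟨η', h', rfl⟩
    exact ⟨η + η', h.add h', extD_add h h'⟩
  smul_mem' := by
    rintro r _ ⟨η, h, rfl⟩
    exact ⟨r • η, h.smul r, extD_smul r η⟩

/-- The de Rham cohomology space of `M` in degree `k + 1`: closed forms modulo exact forms. -/
abbrev DeRhamSucc : Type _ :=
  closedForms E M (k + 1) ⧸ (exactForms E M k).submoduleOf (closedForms E M (k + 1))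

variable {E M k}
/-- The de Rham class of a smooth closed `(k + 1)`-form. -/
def deRhamClass (ω : closedForms E M (k + 1)) : DeRhamSucc E M k := Submodule.Quotient.mk ω

variable [MeasurableSpace E] [BorelSpace E] [FiniteDimensional ℝ E] [MeasurableSpace M]

/-- The measure on the domain of the chart `c` given by the density `|τ|` of a top-degree form `τ`:
in coordinates it is `|τ(b₁, …, bₙ)|` times the Lebesgue measure for which the parallelepiped
spanned by the basis `b` has volume `1`. It does not depend on `b`. -/
def chartMeasure {n : ℕ} (b : Module.Basis (Fin n) ℝ E) (τ : Form E M n)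
    (c : OpenPartialHomeomorph M E) : Measure M :=
  ((b.addHaar.restrict c.target).withDensity
    fun y => ENNReal.ofReal |inChart τ c y b|).map c.symm

/-- The measure on `M` given by the density `|τ|` of a top-degree form `τ`. The measures
`chartMeasure b τ c` agree on overlaps of charts, so on a second countable manifold their supremum
is the measure obtained by gluing them. If `τ` is positive with respect to an orientation of `M`,
the total mass is the integral of `τ` over the oriented manifold `M`. -/
def formMeasure {n : ℕ} (b : Module.Basis (Fin n) ℝ E) (τ : Form E M n) : Measure M :=
  ⨆ c ∈ atlas E M, chartMeasure b τ c
end Forms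

/-! ### `G₂` three-forms and the Hitchin functional -/

section G2

variable {V : Type*} [AddCommGroup V] [Module ℝ V] [TopologicalSpace V]

/-- The three-form
`θ¹²³ + θ¹⁴⁵ + θ¹⁶⁷ + θ²⁴⁶ - θ²⁵⁷ - θ³⁴⁷ - θ³⁵⁶` (the covectors `θ¹, …, θ⁷` are indexed by `Fin 7`,
starting from `0`). -/
def g2Model (θ : Fin 7 → V →L[ℝ] ℝ) : V [⋀^Fin 3]→L[ℝ] ℝ :=
  let e (i j k : Fin 7) := wedge ![θ (i - 1), θ (j - 1), θ (k - 1)]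
  e 1 2 3 + e 1 4 5 + e 1 6 7 + e 2 4 6 - e 2 5 7 - e 3 4 7 - e 3 5 6

/-- `θ` is a correctly oriented basis of covectors of the seven-dimensional space `V`, oriented by
the nonzero top-degree form `ν`, in which `φ` has the standard form. -/
def IsG2Coframe (ν : V [⋀^Fin 7]→L[ℝ] ℝ) (φ : V [⋀^Fin 3]→L[ℝ] ℝ) (θ : Fin 7 → V →L[ℝ] ℝ) : Prop :=
  (∃ r : ℝ, 0 < r ∧ wedge θ = r • ν) ∧ φ = g2Model θ

/-- `φ` is a `G₂` three-form on `V`, oriented by `ν`. -/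
def IsG2 (ν : V [⋀^Fin 7]→L[ℝ] ℝ) (φ : V [⋀^Fin 3]→L[ℝ] ℝ) : Prop := ∃ θ, IsG2Coframe ν φ θ

open Classical in
/-- The volume form `vol_φ = θ¹²³⁴⁵⁶⁷` of a `G₂` three-form `φ`. As the stabiliser of `φ` is `G₂`,
which is contained in `SO(7)`, it does not depend on the choice of `θ`. -/
def g2Vol (ν : V [⋀^Fin 7]→L[ℝ] ℝ) (φ : V [⋀^Fin 3]→L[ℝ] ℝ) : V [⋀^Fin 7]→L[ℝ] ℝ :=
  if h : IsG2 ν φ then wedge h.choose else 0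

end G2

section Hitchin

variable {E : Type*} [NormedAddCommGroup E] [NormedSpace ℝ E]
  {M : Type*} [TopologicalSpace M] [ChartedSpace E M]

/-- For a class `a` in degree-three de Rham cohomology, the set `a₊` of smooth closed `G₂`
three-forms representing `a`. The seven-manifold `M` is oriented by the nowhere vanishing
seven-form `ν`. -/
def plusClass (ν : Form E M 7) (a : DeRhamSucc E M 2) : Set (closedForms E M 3) :=
  {ψ | deRhamClass ψ = a ∧ ∀ x, IsG2 (ν x) (ψ.1 x)}

/-- The volume form of a field of `G₂` three-forms. -/
def volForm (ν : Form E M 7) (φ : Form E M 3) : Form E M 7 := fun x => g2Vol (ν x) (φ x)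

/-- The Hitchin functional: the total volume of `M` with respect to `vol_φ`. -/
def hitchin [MeasurableSpace E] [BorelSpace E] [FiniteDimensional ℝ E] [MeasurableSpace M]
    (b : Module.Basis (Fin 7) ℝ E) (ν : Form E M 7) (φ : Form E M 3) : ℝ≥0∞ :=
  formMeasure b (volForm ν φ) Set.univ

end Hitchin

/-! ### The Nakamura manifold `X` and the seven-manifold `N = X × S¹` -/

/-- The complex Lie group `H`: `ℂ³` with a semidirect product structure. -/
@[ext] structure H where
  w1 : ℂ
  w2 : ℂ
  w3 : ℂ

namespace H

/-- The global coordinates on `H`. -/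
def coords : H ≃ ℂ × ℂ × ℂ where
  toFun u := (u.w1, u.w2, u.w3)
  invFun p := ⟨p.1, p.2.1, p.2.2⟩
  left_inv _ := rfl
  right_inv _ := rfl

instance : TopologicalSpace H := TopologicalSpace.induced coords inferInstance

/-- The global coordinates on `H`, as a homeomorphism. -/
def coordsHomeo : H ≃ₜ ℂ × ℂ × ℂ := coords.toHomeomorphOfIsInducing ⟨rfl⟩

/-- The product `(u¹, u², u³) * (w¹, w², w³) = (u¹ + w¹, e^{-w¹} u² + w², e^{w¹} u³ + w³)`. -/
instance : Mul H :=
  ⟨fun u w => ⟨u.w1 + w.w1, Complex.exp (-w.w1) * u.w2 + w.w2, Complex.exp w.w1 * u.w3 + w.w3⟩⟩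

instance : One H := ⟨⟨0, 0, 0⟩⟩

instance : Inv H := ⟨fun u => ⟨-u.w1, -(Complex.exp u.w1 * u.w2), -(Complex.exp (-u.w1) * u.w3)⟩⟩

@[simp] theorem mul_w1 (u w : H) : (u * w).w1 = u.w1 + w.w1 := rfl
@[simp] theorem mul_w2 (u w : H) : (u * w).w2 = Complex.exp (-w.w1) * u.w2 + w.w2 := rfl
@[simp] theorem mul_w3 (u w : H) : (u * w).w3 = Complex.exp w.w1 * u.w3 + w.w3 := rfl
@[simp] theorem one_w1 : (1 : H).w1 = 0 := rfl
@[simp] theorem one_w2 : (1 : H).w2 = 0 := rfl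
@[simp] theorem one_w3 : (1 : H).w3 = 0 := rfl
@[simp] theorem inv_w1 (u : H) : u⁻¹.w1 = -u.w1 := rfl
@[simp] theorem inv_w2 (u : H) : u⁻¹.w2 = -(Complex.exp u.w1 * u.w2) := rfl
@[simp] theorem inv_w3 (u : H) : u⁻¹.w3 = -(Complex.exp (-u.w1) * u.w3) := rfl

instance : Group H where
  mul_assoc u v w := by
    ext
    · simp; ring
    · simp [Complex.exp_add]; ring
    · simp [Complex.exp_add]; ring
  one_mul u := by ext <;> simp
  mul_one u := by ext <;> simp
  inv_mul_cancel u := by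
    ext
    · simp
    · simp [← mul_assoc, ← Complex.exp_add]
    · simp [← mul_assoc, ← Complex.exp_add]

theorem continuous_w1 : Continuous H.w1 := continuous_fst.comp coordsHomeo.continuous
theorem continuous_w2 : Continuous H.w2 :=
  (continuous_fst.comp continuous_snd).comp coordsHomeo.continuous
theorem continuous_w3 : Continuous H.w3 :=
  (continuous_snd.comp continuous_snd).comp coordsHomeo.continuous

instance : IsTopologicalGroup H where
  continuous_mul := by
    have h1 := continuous_w1
    have h2 := continuous_w2
    have h3 := continuous_w3
    refine continuous_induced_rng.2 ?_
    change Continuous fun p : H × H => (p.1.w1 + p.2.w1,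
      Complex.exp (-p.2.w1) * p.1.w2 + p.2.w2, Complex.exp p.2.w1 * p.1.w3 + p.2.w3)
    fun_prop
  continuous_inv := by
    have h1 := continuous_w1
    have h2 := continuous_w2
    have h3 := continuous_w3
    refine continuous_induced_rng.2 ?_
    change Continuous fun u : H =>
      (-u.w1, -(Complex.exp u.w1 * u.w2), -(Complex.exp (-u.w1) * u.w3))
    fun_prop

end H

/-- The constant `ℓ`. -/
def ell : ℝ := Real.log ((3 + √5) / 2)

/-- The constant `m`. -/
def m : ℝ := (√5 - 1) / 2

open Complex in
/-- The subgroup `Δ` generated by `e₁, …, e₆`. -/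
def Del : Subgroup H := Subgroup.closure
  {⟨ell, 0, 0⟩, ⟨2 * Real.pi * I, 0, 0⟩, ⟨0, -m, 1⟩, ⟨0, 1, m⟩,
   ⟨0, -(2 * Real.pi * I * m), 2 * Real.pi * I⟩, ⟨0, 2 * Real.pi * I, 2 * Real.pi * I * m⟩}

theorem m_sq : m ^ 2 = 1 - m := by
  have h : √5 ^ 2 = 5 := Real.sq_sqrt (by norm_num)
  rw [m]; nlinarith

theorem m_pos : 0 < m := by
  have : (1 : ℝ) < √5 := by rw [Real.lt_sqrt (by norm_num)]; norm_num
  rw [m]; linarith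

theorem one_lt_sqrt_five : (1 : ℝ) < √5 := by
  rw [Real.lt_sqrt (by norm_num)]; norm_num

theorem exp_ell : Real.exp ell = 2 + m := by
  rw [ell, Real.exp_log (by positivity), m]; ring

theorem ell_pos : 0 < ell :=
  Real.log_pos (by linarith [one_lt_sqrt_five])

theorem exp_neg_ell : Real.exp (-ell) = 1 - m := by
  rw [Real.exp_neg, exp_ell]
  have := m_sq
  have := m_pos
  exact inv_eq_of_mul_eq_one_right (by nlinarith)

/-- The additive group `ℤ + 2πiℤ`. -/
def Zt (z : ℂ) : Prop := ∃ c d : ℤ, z = c + d * (2 * (Real.pi : ℂ) * Complex.I)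

theorem Zt.add {z w : ℂ} : Zt z → Zt w → Zt (z + w) := by
  rintro ⟨c, d, rfl⟩ ⟨c', d', rfl⟩
  exact ⟨c + c', d + d', by push_cast; ring⟩

theorem Zt.neg {z : ℂ} : Zt z → Zt (-z) := by
  rintro ⟨c, d, rfl⟩
  exact ⟨-c, -d, by push_cast; ring⟩

theorem Zt.eq_zero {z : ℂ} (h : Zt z) (hz : ‖z‖ < 1) : z = 0 := by
  obtain ⟨c, d, rfl⟩ := h
  have h1 := (Complex.abs_re_le_norm _).trans_lt hz
  have h2 := (Complex.abs_im_le_norm _).trans_lt hz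
  simp at h1 h2
  have hc : c = 0 := by
    rw [← Int.abs_lt_one_iff]
    exact_mod_cast h1
  have hd : d = 0 := by
    rw [← Int.abs_lt_one_iff]
    have hp := Real.pi_gt_three
    rw [abs_of_pos Real.pi_pos] at h2
    have : |(d : ℝ)| < 1 := by nlinarith [abs_nonneg (d : ℝ)]
    exact_mod_cast this
  simp [hc, hd]

/-- An explicit set of representatives containing `Δ`. -/
def Lat (u : H) : Prop :=
  (∃ a b : ℤ, u.w1 = a * ell + b * (2 * (Real.pi : ℂ) * Complex.I)) ∧
    ∃ x y : ℂ, Zt x ∧ Zt y ∧ u.w2 = -m * x + y ∧ u.w3 = x + m * y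

theorem m_sq' : (m : ℂ) ^ 2 = 1 - m := by exact_mod_cast m_sq
theorem exp_ell' : Complex.exp ell = 2 + m := by exact_mod_cast exp_ell
theorem exp_neg_ell' : Complex.exp (-ell) = 1 - m := by exact_mod_cast exp_neg_ell

theorem Lat.add {u w : H} (hu : Lat u) (hw : Lat w) (h : w.w1 = 0) : Lat (u * w) := by
  obtain ⟨⟨a, b, hu1⟩, x, y, hx, hy, h2, h3⟩ := hu
  obtain ⟨-, x', y', hx', hy', h2', h3'⟩ := hw
  refine ⟨⟨a, b, ?_⟩, x + x', y + y', hx.add hx', hy.add hy', ?_, ?_⟩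
  · simp [h, hu1]
  · simp [h, h2, h2']; ring
  · simp [h, h3, h3']; ring

theorem Lat.inv {u : H} (hu : Lat u) (h : u.w1 = 0) : Lat u⁻¹ := by
  obtain ⟨⟨a, b, hu1⟩, x, y, hx, hy, h2, h3⟩ := hu
  refine ⟨⟨0, 0, ?_⟩, -x, -y, hx.neg, hy.neg, ?_, ?_⟩
  · simp [h]
  · simp [h, h2]; ring
  · simp [h, h3]; ring

theorem lat_of_mem {u : H} (hu : u ∈ Del) : Lat u := by
  have z0 : Zt 0 := ⟨0, 0, by simp⟩
  have z1 : Zt 1 := ⟨1, 0, by simp⟩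
  have zt : Zt (2 * (Real.pi : ℂ) * Complex.I) := ⟨0, 1, by simp⟩
  have hm := m_sq'
  have he : Complex.exp (2 * (Real.pi : ℂ) * Complex.I) = 1 := Complex.exp_two_pi_mul_I
  have he' : Complex.exp (-(2 * (Real.pi : ℂ) * Complex.I)) = 1 := by
    rw [Complex.exp_neg, he, inv_one]
  have l3 : Lat ⟨0, -(m : ℂ), (1 : ℂ)⟩ :=
    ⟨⟨0, 0, by simp⟩, 1, 0, z1, z0, by simp, by simp⟩
  have l4 : Lat ⟨0, (1 : ℂ), (m : ℂ)⟩ :=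
    ⟨⟨0, 0, by simp⟩, 0, 1, z0, z1, by simp, by simp⟩
  have l5 : Lat ⟨0, -(2 * (Real.pi : ℂ) * Complex.I * (m : ℂ)),
      2 * (Real.pi : ℂ) * Complex.I⟩ :=
    ⟨⟨0, 0, by simp⟩, _, 0, zt, z0, by simp; ring, by simp⟩
  have l6 : Lat ⟨0, 2 * (Real.pi : ℂ) * Complex.I, 2 * (Real.pi : ℂ) * Complex.I * (m : ℂ)⟩ :=
    ⟨⟨0, 0, by simp⟩, 0, _, z0, zt, by simp, by simp; ring⟩
  induction hu using Subgroup.closure_induction_right with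
  | one => exact ⟨⟨0, 0, by simp⟩, 0, 0, z0, z0, by simp, by simp⟩
  | mul_right u _ w hw ih =>
    rcases hw with rfl | rfl | rfl | rfl | rfl | rfl
    · obtain ⟨⟨a, b, hu1⟩, x, y, hx, hy, h2, h3⟩ := ih
      refine ⟨⟨a + 1, b, ?_⟩, x + x + y, x + y, (hx.add hx).add hy, hx.add hy, ?_, ?_⟩
      · simp [hu1]; ring
      · simp [h2, exp_neg_ell']; linear_combination x * hm
      · simp [h3, exp_ell']; linear_combination y * hm
    · obtain ⟨⟨a, b, hu1⟩, x, y, hx, hy, h2, h3⟩ := ih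
      refine ⟨⟨a, b + 1, ?_⟩, x, y, hx, hy, ?_, ?_⟩
      · simp [hu1]; ring
      · simp [h2, he']
      · simp [h3, he]
    · exact ih.add l3 rfl
    · exact ih.add l4 rfl
    · exact ih.add l5 rfl
    · exact ih.add l6 rfl
  | mul_inv_cancel u _ w hw ih =>
    rcases hw with rfl | rfl | rfl | rfl | rfl | rfl
    · obtain ⟨⟨a, b, hu1⟩, x, y, hx, hy, h2, h3⟩ := ih
      refine ⟨⟨a - 1, b, ?_⟩, x + -y, -x + (y + y), hx.add hy.neg, hx.neg.add (hy.add hy), ?_, ?_⟩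
      · simp [hu1]; ring
      · simp [h2, exp_ell']; linear_combination -x * hm
      · simp [h3, exp_neg_ell']; linear_combination -y * hm
    · obtain ⟨⟨a, b, hu1⟩, x, y, hx, hy, h2, h3⟩ := ih
      refine ⟨⟨a, b - 1, ?_⟩, x, y, hx, hy, ?_, ?_⟩
      · simp [hu1]; ring
      · simp [h2, he]
      · simp [h3, he']
    · exact ih.add (l3.inv rfl) (by simp)
    · exact ih.add (l4.inv rfl) (by simp)
    · exact ih.add (l5.inv rfl) (by simp)
    · exact ih.add (l6.inv rfl) (by simp)

theorem isDiscrete_Del : IsDiscrete (Del : Set H) := by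
  rw [isDiscrete_iff_discreteTopology]
  change DiscreteTopology Del
  rw [discreteTopology_iff_isOpen_singleton_one, isOpen_induced_iff]
  have hcont : Continuous fun u : H => (u.w1.re, u.w1.im, (u.w3 - m * u.w2) / (1 + m ^ 2),
      (u.w2 + m * u.w3) / (1 + m ^ 2)) := by
    have h1 := H.continuous_w1
    have h2 := H.continuous_w2
    have h3 := H.continuous_w3
    fun_prop
  refine ⟨_, ((isOpen_lt continuous_abs continuous_const :
    IsOpen {t : ℝ | |t| < ell}).prod ((isOpen_lt continuous_abs continuous_const :
    IsOpen {t : ℝ | |t| < 1}).prod ((Metric.isOpen_ball (x := (0 : ℂ)) (ε := 1)).prod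
    (Metric.isOpen_ball (x := (0 : ℂ)) (ε := 1))))).preimage hcont, ?_⟩
  have hne : (1 + (m : ℂ) ^ 2) ≠ 0 := by
    have : (1 + m ^ 2 : ℝ) ≠ 0 := by positivity
    exact_mod_cast this
  ext ⟨u, hu⟩
  constructor
  · rintro ⟨h1, h2, h3, h4⟩
    obtain ⟨⟨a, b, hu1⟩, x, y, hx, hy, e2, e3⟩ := lat_of_mem hu
    have ex : (u.w3 - m * u.w2) / (1 + (m : ℂ) ^ 2) = x := by
      rw [e2, e3]; field_simp; ring
    have ey : (u.w2 + m * u.w3) / (1 + (m : ℂ) ^ 2) = y := by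
      rw [e2, e3]; field_simp; ring
    simp only [ex, ey, mem_ball_zero_iff] at h3 h4
    have hx0 := hx.eq_zero h3
    have hy0 := hy.eq_zero h4
    simp [hu1, abs_mul, abs_of_pos Real.pi_pos, abs_of_pos ell_pos] at h1 h2
    have ha : a = 0 := by
      rw [← Int.abs_lt_one_iff]
      have : |(a : ℝ)| < 1 := by nlinarith [ell_pos]
      exact_mod_cast this
    have hb : b = 0 := by
      rw [← Int.abs_lt_one_iff]
      have hp := Real.pi_gt_three
      have : |(b : ℝ)| < 1 := by nlinarith [abs_nonneg (b : ℝ)]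
      exact_mod_cast this
    refine Subtype.ext (H.ext ?_ ?_ ?_)
    · simp [hu1, ha, hb]
    · simp [e2, hx0, hy0]
    · simp [e3, hx0, hy0]
  · intro h
    obtain rfl : u = 1 := congrArg Subtype.val h
    simp [ell_pos]


/-- The Nakamura manifold `X = H / Δ`. -/
abbrev X : Type := H ⧸ Del

/-- The circle `ℝ / 2πℤ`. -/
abbrev S1 : Type := AddCircle (2 * Real.pi)

/-- The seven-manifold `N = X × S¹`. -/
def N : Type := X × S1

instance : TopologicalSpace N := inferInstanceAs (TopologicalSpace (X × S1))

instance : MeasurableSpace N := borel N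

instance : BorelSpace N := ⟨rfl⟩

/-- The model space of `N`, which is also the underlying space of its universal covering `H × ℝ`. -/
abbrev E : Type := (ℂ × ℂ × ℂ) × ℝ

/-- The universal covering `H × ℝ → X × S¹`. -/
def proj (e : E) : N := ((H.coordsHomeo.symm e.1 : X), (e.2 : S1))

theorem isLocalHomeomorph_prodMap {A B C D : Type*} [TopologicalSpace A] [TopologicalSpace B]
    [TopologicalSpace C] [TopologicalSpace D] {f : A → B} {g : C → D} (hf : IsLocalHomeomorph f)
    (hg : IsLocalHomeomorph g) : IsLocalHomeomorph (Prod.map f g) := by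
  rintro ⟨a, c⟩
  obtain ⟨e, he, rfl⟩ := hf a
  obtain ⟨e', he', rfl⟩ := hg c
  exact ⟨e.prod e', ⟨he, he'⟩, rfl⟩

theorem isLocalHomeomorph_proj : IsLocalHomeomorph proj := by
  have h1 : IsLocalHomeomorph ((↑) : H → X) :=
    (Del.isQuotientCoveringMap isDiscrete_Del).isCoveringMap.isLocalHomeomorph
  have h2 : IsLocalHomeomorph ((↑) : ℝ → S1) := AddCircle.isLocalHomeomorph_coe _
  exact isLocalHomeomorph_prodMap (h1.comp H.coordsHomeo.symm.isLocalHomeomorph) h2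

theorem proj_surjective : Function.Surjective proj := by
  rintro ⟨x, t⟩
  obtain ⟨u, rfl⟩ := QuotientGroup.mk_surjective x
  obtain ⟨r, rfl⟩ := QuotientAddGroup.mk_surjective t
  exact ⟨(H.coordsHomeo u, r), by simp [proj]; rfl⟩

/-- A choice of a preimage of every point under the universal covering. -/
def lift : N → E := Function.surjInv proj_surjective

theorem proj_lift (q : N) : proj (lift q) = q := Function.surjInv_eq proj_surjective q

/-- The charts of `N` are the local inverses of the universal covering. -/
instance : ChartedSpace E N where
  atlas := Set.range fun e : E => isLocalHomeomorph_proj.localInverseAt e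
  chartAt q := isLocalHomeomorph_proj.localInverseAt (lift q)
  mem_chart_source q := by
    simpa [proj_lift] using
      isLocalHomeomorph_proj.apply_self_mem_localInverseAt_source (x := lift q)
  chart_mem_atlas q := ⟨lift q, rfl⟩

/-- Deck transformations of the universal covering. -/
def deck (δ : H) (n : ℤ) (e : E) : E :=
  ((e.1.1 + δ.w1, Complex.exp (-δ.w1) * e.1.2.1 + δ.w2, Complex.exp δ.w1 * e.1.2.2 + δ.w3),
    e.2 + n * (2 * Real.pi))

theorem contDiff_deck (δ : H) (n : ℤ) {k : WithTop ℕ∞} : ContDiff ℝ k (deck δ n) := by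
  unfold deck
  fun_prop

theorem proj_deck {δ : H} (hδ : δ ∈ Del) (n : ℤ) (e : E) : proj (deck δ n e) = proj e := by
  refine Prod.ext ?_ ?_
  · change ((H.coordsHomeo.symm e.1 * δ : H) : X) = (H.coordsHomeo.symm e.1 : X)
    rw [QuotientGroup.mk_mul_of_mem _ hδ]
  · change ((e.2 + n * (2 * Real.pi) : ℝ) : S1) = (e.2 : S1)
    exact (QuotientAddGroup.mk_add_of_mem _ (AddSubgroup.mem_zmultiples_iff.2
      ⟨n, zsmul_eq_mul _ _⟩))

theorem exists_deck {e e' : E} (h : proj e = proj e') : ∃ δ ∈ Del, ∃ n, e' = deck δ n e := by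
  have h1 : (H.coordsHomeo.symm e.1 : X) = (H.coordsHomeo.symm e'.1 : X) := congrArg Prod.fst h
  have h2 : (e.2 : S1) = (e'.2 : S1) := congrArg Prod.snd h
  rw [QuotientGroup.eq] at h1
  rw [QuotientAddGroup.eq, AddSubgroup.mem_zmultiples_iff] at h2
  obtain ⟨n, hn⟩ := h2
  refine ⟨_, h1, n, Prod.ext ?_ ?_⟩
  · apply H.coordsHomeo.symm.injective
    exact (mul_inv_cancel_left (H.coordsHomeo.symm e.1) (H.coordsHomeo.symm e'.1)).symm
  · simp only [zsmul_eq_mul] at hn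
    simp [deck, hn]

/-- Any chart, composed with the covering map, is locally a deck transformation. -/
theorem chart_comp_proj {c : OpenPartialHomeomorph N E} (hc : c ∈ atlas E N) {y : E}
    (hy : proj y ∈ c.source) : ∃ δ ∈ Del, ∃ n, (fun z => c (proj z)) =ᶠ[nhds y] deck δ n := by
  obtain ⟨e, rfl⟩ := hc
  set c := isLocalHomeomorph_proj.localInverseAt e
  have hcs : (c.symm : E → N) = proj := isLocalHomeomorph_proj.localInverseAt_symm e
  obtain ⟨δ, hδ, n, hd⟩ := exists_deck (e := y) (e' := c (proj y))
    (by rw [← hcs, hcs, ← congrFun hcs (c _), c.left_inv hy])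
  refine ⟨δ, hδ, n, ?_⟩
  have h1 : c.target ∈ nhds (deck δ n y) := c.open_target.mem_nhds (hd ▸ c.map_source hy)
  filter_upwards [(contDiff_deck δ n (k := 0)).continuous.continuousAt h1] with z hz
  rw [← proj_deck hδ n z, ← congrFun hcs, c.right_inv hz]

theorem symm_eq_proj {c : OpenPartialHomeomorph N E} (hc : c ∈ atlas E N) :
    (c.symm : E → N) = proj := by
  obtain ⟨e, rfl⟩ := hc
  exact isLocalHomeomorph_proj.localInverseAt_symm e

instance : IsManifold 𝓘(ℝ, E) ((⊤ : ℕ∞) : WithTop ℕ∞) N := by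
  refine isManifold_of_contDiffOn _ _ _ fun c c' hc hc' y hy => ?_
  have hcs := symm_eq_proj hc
  simp [hcs] at hy
  obtain ⟨δ, -, n, hd⟩ := chart_comp_proj hc' hy.2
  refine ContDiffAt.contDiffWithinAt ?_
  refine ((contDiff_deck δ n).contDiffAt).congr_of_eventuallyEq ?_
  filter_upwards [hd] with z hz
  simpa [hcs] using hz


/-- The one-form on `N` induced by a one-form on the universal covering which is invariant under
deck transformations (a chart of `N` is a local inverse of the covering). -/
def descend {A : Type*} [NormedAddCommGroup A] [NormedSpace ℝ A] (θ : E → E →L[ℝ] A) (q : N) :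
    TangentSpace 𝓘(ℝ, E) q →L[ℝ] A :=
  (θ (chartAt E q q)) ∘L (mfderiv 𝓘(ℝ, E) 𝓘(ℝ, E) (chartAt E q) q)

/-- If `θ` is invariant under deck transformations, then the pullback of `descend θ` along the
universal covering is `θ`. -/
theorem descend_proj {A : Type*} [NormedAddCommGroup A] [NormedSpace ℝ A] {θ : E → E →L[ℝ] A}
    (hθ : ∀ δ ∈ Del, ∀ n e, θ (deck δ n e) ∘L fderiv ℝ (deck δ n) e = θ e) (e : E) :
    (descend θ (proj e)) ∘L (mfderiv 𝓘(ℝ, E) 𝓘(ℝ, E) proj e) = θ e := by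
  set c := chartAt E (proj e)
  have hc : c ∈ atlas E N := chart_mem_atlas E _
  have hs : proj e ∈ c.source := mem_chart_source E _
  obtain ⟨δ, hδ, n, hd⟩ := chart_comp_proj hc hs
  have hp : MDifferentiableAt 𝓘(ℝ, E) 𝓘(ℝ, E) proj e := by
    obtain ⟨c', hc', he⟩ : ∃ c' ∈ atlas E N, e ∈ c'.target :=
      ⟨isLocalHomeomorph_proj.localInverseAt e, ⟨e, rfl⟩,
        isLocalHomeomorph_proj.self_mem_localInverseAt_target⟩
    rw [← symm_eq_proj hc']
    exact mdifferentiableAt_atlas_symm hc' he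
  have hcd : MDifferentiableAt 𝓘(ℝ, E) 𝓘(ℝ, E) c (proj e) := mdifferentiableAt_atlas hc hs
  have hcomp := mfderiv_comp e hcd hp
  have : mfderiv 𝓘(ℝ, E) 𝓘(ℝ, E) (c ∘ proj) e = fderiv ℝ (deck δ n) e := by
    rw [mfderiv_eq_fderiv]
    exact hd.fderiv_eq
  rw [this] at hcomp
  have hv : c (proj e) = deck δ n e := hd.self_of_nhds
  rw [← hθ δ hδ n e, hcomp]
  change (θ (c (proj e)) ∘L _) ∘L _ = _
  rw [hv]
  rfl

/-! ### The three-forms on `N` -/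

/-- The differentials `dw¹`, `dw²`, `dw³`, `dt` of the coordinates on `H × ℝ`. -/
def dw1 : E →L[ℝ] ℂ := ContinuousLinearMap.fst ℝ ℂ (ℂ × ℂ) ∘L ContinuousLinearMap.fst ℝ _ ℝ
def dw2 : E →L[ℝ] ℂ :=
  ContinuousLinearMap.fst ℝ ℂ ℂ ∘L ContinuousLinearMap.snd ℝ ℂ (ℂ × ℂ) ∘L
    ContinuousLinearMap.fst ℝ _ ℝ
def dw3 : E →L[ℝ] ℂ :=
  ContinuousLinearMap.snd ℝ ℂ ℂ ∘L ContinuousLinearMap.snd ℝ ℂ (ℂ × ℂ) ∘L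
    ContinuousLinearMap.fst ℝ _ ℝ
def dt : E →L[ℝ] ℝ := ContinuousLinearMap.snd ℝ (ℂ × ℂ × ℂ) ℝ

/-- The right-invariant one-form `Θ¹ = dw¹`, on the covering. -/
def coverTheta1 (_ : E) : E →L[ℝ] ℂ := dw1
/-- The right-invariant one-form `Θ² = e^{w¹} dw²`, on the covering. -/
def coverTheta2 (e : E) : E →L[ℝ] ℂ := Complex.exp e.1.1 • dw2
/-- The right-invariant one-form `Θ³ = e^{-w¹} dw³`, on the covering. -/
def coverTheta3 (e : E) : E →L[ℝ] ℂ := Complex.exp (-e.1.1) • dw3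

/-- The one-forms `Θ¹`, `Θ²`, `Θ³` on `N`. -/
def Theta1 (x : N) : TangentSpace 𝓘(ℝ, E) x →L[ℝ] ℂ := descend coverTheta1 x
def Theta2 (x : N) : TangentSpace 𝓘(ℝ, E) x →L[ℝ] ℂ := descend coverTheta2 x
def Theta3 (x : N) : TangentSpace 𝓘(ℝ, E) x →L[ℝ] ℂ := descend coverTheta3 x

/-- `g¹ = Re Θ¹`. -/
def g1 (x : N) : TangentSpace 𝓘(ℝ, E) x →L[ℝ] ℝ := Complex.reCLM ∘L Theta1 x
/-- `g² = Im Θ¹`. -/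
def g2 (x : N) : TangentSpace 𝓘(ℝ, E) x →L[ℝ] ℝ := Complex.imCLM ∘L Theta1 x
/-- `g³`, the canonical one-form `dt` on the factor `S¹ = ℝ / 2πℤ`. -/
def g3 (x : N) : TangentSpace 𝓘(ℝ, E) x →L[ℝ] ℝ := descend (fun _ => dt) x

theorem hasFDerivAt_deck (δ : H) (n : ℤ) (e : E) : HasFDerivAt (deck δ n)
    ((dw1.prod ((Complex.exp (-δ.w1) • dw2).prod (Complex.exp δ.w1 • dw3))).prod dt) e := by
  have h1 : HasFDerivAt (fun e : E => e.1.1) dw1 e := dw1.hasFDerivAt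
  have h2 : HasFDerivAt (fun e : E => e.1.2.1) dw2 e := dw2.hasFDerivAt
  have h3 : HasFDerivAt (fun e : E => e.1.2.2) dw3 e := dw3.hasFDerivAt
  have h4 : HasFDerivAt (fun e : E => e.2) dt e := dt.hasFDerivAt
  exact ((h1.add_const _).prodMk (((h2.const_smul (Complex.exp (-δ.w1))).add_const _).prodMk
    ((h3.const_smul (Complex.exp δ.w1)).add_const _))).prodMk (h4.add_const _)

/-- The pullbacks of the forms on `N` to the universal covering. -/
theorem Theta1_proj (e : E) :
    (Theta1 (proj e)) ∘L (mfderiv 𝓘(ℝ, E) 𝓘(ℝ, E) proj e) = coverTheta1 e := by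
  refine descend_proj (fun δ _ n e => ?_) e
  rw [(hasFDerivAt_deck δ n e).fderiv]
  rfl
theorem Theta2_proj (e : E) :
    (Theta2 (proj e)) ∘L (mfderiv 𝓘(ℝ, E) 𝓘(ℝ, E) proj e) = coverTheta2 e := by
  refine descend_proj (fun δ _ n e => ?_) e
  rw [(hasFDerivAt_deck δ n e).fderiv]
  refine ContinuousLinearMap.ext fun v => ?_
  change Complex.exp (e.1.1 + δ.w1) * (Complex.exp (-δ.w1) * dw2 v) = Complex.exp e.1.1 * dw2 v
  rw [← mul_assoc, ← Complex.exp_add, add_neg_cancel_right]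
theorem Theta3_proj (e : E) :
    (Theta3 (proj e)) ∘L (mfderiv 𝓘(ℝ, E) 𝓘(ℝ, E) proj e) = coverTheta3 e := by
  refine descend_proj (fun δ _ n e => ?_) e
  rw [(hasFDerivAt_deck δ n e).fderiv]
  refine ContinuousLinearMap.ext fun v => ?_
  change Complex.exp (-(e.1.1 + δ.w1)) * (Complex.exp δ.w1 * dw3 v) = Complex.exp (-e.1.1) * dw3 v
  rw [← mul_assoc, ← Complex.exp_add]
  congr 2
  ring
theorem g3_proj (e : E) :
    (g3 (proj e)) ∘L (mfderiv 𝓘(ℝ, E) 𝓘(ℝ, E) proj e) = dt := by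
  refine descend_proj (fun δ _ n e => ?_) e
  rw [(hasFDerivAt_deck δ n e).fderiv]
  rfl

/-- A real covector as a complex-valued one. -/
def toComplex {V : Type*} [AddCommGroup V] [Module ℝ V] [TopologicalSpace V] (g : V →L[ℝ] ℝ) :
    V →L[ℝ] ℂ := Complex.ofRealCLM ∘L g

/-- The complex conjugate of a complex-valued covector. -/
def conj {V : Type*} [AddCommGroup V] [Module ℝ V] [TopologicalSpace V] (θ : V →L[ℝ] ℂ) :
    V →L[ℝ] ℂ := Complex.conjCLE.toContinuousLinearMap ∘L θ

/-- `g¹²³ = g¹ ∧ g² ∧ g³`. -/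
def g123 : Form E N 3 := fun x => wedge ![g1 x, g2 x, g3 x]

/-- `g¹ ∧ ω`, where `ω` is the real form `(i/2) (Θ² ∧ Θ̄² + Θ³ ∧ Θ̄³)`. -/
def g1Omega : Form E N 3 := fun x =>
  Complex.reCLM.compContinuousAlternatingMap ((Complex.I / 2) •
    (wedge ![toComplex (g1 x), Theta2 x, conj (Theta2 x)] +
      wedge ![toComplex (g1 x), Theta3 x, conj (Theta3 x)]))

/-- `g² ∧ Re(λ Ω)`, where `Ω = Θ² ∧ Θ³`. -/
def g2ReOmega (l : ℂ) : Form E N 3 := fun x =>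
  Complex.reCLM.compContinuousAlternatingMap (l • wedge ![toComplex (g2 x), Theta2 x, Theta3 x])

/-- `g³ ∧ Im(λ Ω)`, where `Ω = Θ² ∧ Θ³`. -/
def g3ImOmega (l : ℂ) : Form E N 3 := fun x =>
  Complex.imCLM.compContinuousAlternatingMap (l • wedge ![toComplex (g3 x), Theta2 x, Theta3 x])

/-- The parameters `(α, β, λ)`, all nonzero. -/
abbrev Params : Type := ℝˣ × ℝˣ × ℂˣ

namespace Params

/-- The parameter `α`. -/
abbrev α (p : Params) : ℝ := p.1
/-- The parameter `β`. -/
abbrev β (p : Params) : ℝ := p.2.1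
/-- The parameter `λ`. -/
abbrev l (p : Params) : ℂ := p.2.2

end Params

/-- The three-form `φ(α, β, λ) = αβ g¹²³ + α g¹ ∧ ω - β g² ∧ Re(λ Ω) + g³ ∧ Im(λ Ω)` on `N`. -/
def phi (p : Params) : Form E N 3 :=
  (p.α * p.β) • g123 + p.α • g1Omega - p.β • g2ReOmega p.l + g3ImOmega p.l

/-- The three-form
`φ(α, β, λ; μ) = αβ g¹²³ + α μ⁶ g¹ ∧ ω - β g² ∧ Re(λ Ω) + g³ ∧ Im(λ Ω)` on `N`. -/
def phiScaled (p : Params) (μ : ℝ) : Form E N 3 :=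
  (p.α * p.β) • g123 + (p.α * μ ^ 6) • g1Omega - p.β • g2ReOmega p.l + g3ImOmega p.l

/-- The orientation of `N` given by `αβ g¹²³ ∧ ω²`, i.e. by
`αβ g¹²³ ∧ Re Θ² ∧ Im Θ² ∧ Re Θ³ ∧ Im Θ³`. It is the one for which `φ(α, β, λ)` is a `G₂` form. -/
def orient (p : Params) : Form E N 7 := fun x =>
  (p.α * p.β) • wedge ![g1 x, g2 x, g3 x, Complex.reCLM ∘L Theta2 x, Complex.imCLM ∘L Theta2 x,
    Complex.reCLM ∘L Theta3 x, Complex.imCLM ∘L Theta3 x]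

theorem finrank_E : Module.finrank ℝ E = 7 := by
  simp [E]

/-- A basis of the model space of `N` (the Hitchin functional does not depend on its choice). -/
def basisE : Module.Basis (Fin 7) ℝ E := Module.finBasisOfFinrankEq ℝ E finrank_E

/-- The Hitchin functional on `N`, oriented by `ν`. -/
def hitchinN (ν : Form E N 7) (ψ : closedForms E N 3) : ℝ≥0∞ := hitchin basisE ν ψ.1

end HitchinNakamura

end

/-! Forms on `N` are the same as deck-invariant forms on the universal covering `E`, and all
smoothness, closedness and exactness questions are answered there. The coefficients `e^{w¹}` and
`e^{-w¹}` of `Θ²` and `Θ³` cancel in `Ω`, so three of the four summands of `φ` have constant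
coefficients. The fourth, `g¹ ∧ ω`, is exact: the two halves of `ω` grow like `e^{2x}` and `e^{-2x}`
with `x = Re w¹`, so half their difference is a primitive (`extD_g1OmegaPrimitive`). Changing the
coefficient of `g¹ ∧ ω` therefore does not change the class, while an explicit coframe shows that it
multiplies the volume form by `μ⁴` (`isG2Coframe_scaledCoframe`).

Injectivity comes from periods. By Stokes (`eq_zero_of_exact_of_torus`) an exact form has zero
integral over every three-torus that deck transformations cut out of an affine subspace of `E`;
suitable tori read off `αβ`, the real and imaginary parts of `λ`, and `β Re λ`, `β Im λ`, hence all
the parameters.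

The volume form of a `G₂` form must be shown to be well defined and, for an arbitrary member of the
class, to have a continuous density, since it is defined through a choice of coframe. Both follow
from Hitchin's reconstruction: the contractions `ι_u φ` determine the quadratic form `|det θ|
|θ(u)|²`, whose Gram determinant is `|det θ|⁹` (`det_hitchinGram`). So the density is the ninth root
of a continuous function of `φ`. It is finite in total because a ball of `E` covers `N`
(`exists_deck_mem_ball`, `formMeasure_univ_le`), and positive because it vanishes nowhere. -/

noncomputable section

namespace HitchinNakamura

/-! ### Linear algebra of `G₂` three-forms: Hitchin's quadratic form and the volume. -/

section

open Matrix

/-- The matrix of the two-form `ι_u φ₀`, where `φ₀` is the standard `G₂` three-form on `ℝ⁷`. -/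
def contractionMatrix (u : Fin 7 → ℝ) : Matrix (Fin 7) (Fin 7) ℝ :=
  !![0, u 2, -u 1, u 4, -u 3, u 6, -u 5;
     -u 2, 0, u 0, u 5, -u 6, -u 3, u 4;
     u 1, -u 0, 0, -u 6, -u 5, u 4, u 3;
     -u 4, -u 5, u 6, 0, u 0, u 1, -u 2;
     u 3, u 6, u 5, -u 0, 0, -u 2, -u 1;
     -u 6, u 3, -u 4, -u 1, u 2, 0, u 0;
     u 5, -u 4, -u 3, u 2, u 1, -u 0, 0]

/-- The double cross product identity `u × (u × v) = (u · v) u - |u|² v` for the octonionic cross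
product. Everything below about determinants uses only this, skewness, and `u × u = 0`. -/
theorem contractionMatrix_mul_self (u : Fin 7 → ℝ) :
    contractionMatrix u * contractionMatrix u = vecMulVec u u - (u ⬝ᵥ u) • 1 := by
  ext i j
  simp only [contractionMatrix, Matrix.mul_apply, vecMulVec_apply, Matrix.sub_apply,
    Matrix.smul_apply, dotProduct, Fin.sum_univ_succ]
  fin_cases i <;> fin_cases j <;> simp <;> ring

theorem contractionMatrix_transpose (u : Fin 7 → ℝ) :
    (contractionMatrix u)ᵀ = -contractionMatrix u := by
  ext i j
  fin_cases i <;> fin_cases j <;> simp [contractionMatrix]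

theorem contractionMatrix_mulVec_self (u : Fin 7 → ℝ) : contractionMatrix u *ᵥ u = 0 := by
  ext i
  fin_cases i <;> simp [contractionMatrix, mulVec, dotProduct, Fin.sum_univ_succ] <;> ring

theorem vecMul_contractionMatrix_self (u : Fin 7 → ℝ) : u ᵥ* contractionMatrix u = 0 := by
  rw [← mulVec_transpose, contractionMatrix_transpose, neg_mulVec, contractionMatrix_mulVec_self,
    neg_zero]

/-- The contraction matrix is singular, with kernel containing `u`; adding `u uᵀ` makes it
invertible for `u ≠ 0`. Its product with its transpose has eigenvalue `|u|²` on the six-dimensional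
complement of `u` and `|u|⁴` on `u`. -/
theorem det_contractionMatrix_add_sq (u : Fin 7 → ℝ) :
    (contractionMatrix u + vecMulVec u u).det ^ 2 = (u ⬝ᵥ u) ^ 8 := by
  set r := u ⬝ᵥ u with hr
  have h1 : (contractionMatrix u + vecMulVec u u) * (contractionMatrix u + vecMulVec u u)ᵀ =
      r • 1 + (r - 1) • vecMulVec u u := by
    rw [transpose_add, contractionMatrix_transpose, transpose_vecMulVec, add_mul, mul_add, mul_add,
      mul_neg, contractionMatrix_mul_self, mul_vecMulVec, contractionMatrix_mulVec_self, mul_neg,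
      vecMulVec_mul, vecMul_contractionMatrix_self, vecMulVec_mul_vecMulVec, ← hr]
    simp [sub_smul]
    abel
  have h2 : (r • (1 : Matrix (Fin 7) (Fin 7) ℝ) + (r - 1) • vecMulVec u u).det = r ^ 8 := by
    by_cases h0 : r = 0
    · have : u = 0 := by simpa [hr] using h0
      simp [h0, this]
    · have : r • (1 : Matrix (Fin 7) (Fin 7) ℝ) + (r - 1) • vecMulVec u u =
          r • (1 + vecMulVec (((r - 1) / r) • u) u) := by
        rw [smul_add, smul_vecMulVec, smul_smul, mul_div_cancel₀ _ h0]
      rw [this, det_smul, vecMulVec_eq Unit, det_one_add_replicateCol_mul_replicateRow,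
        dotProduct_smul, ← hr]
      simp
      field_simp
      ring
  have := congrArg det h1
  rwa [det_mul, det_transpose, h2, ← sq] at this

theorem abs_det_contractionMatrix_add (u : Fin 7 → ℝ) :
    |(contractionMatrix u + vecMulVec u u).det| = (u ⬝ᵥ u) ^ 4 := by
  have h := det_contractionMatrix_add_sq u
  have h' : 0 ≤ (u ⬝ᵥ u) ^ 4 := by positivity
  rw [← abs_of_nonneg h', ← sq_eq_sq_iff_abs_eq_abs, h]
  ring

/-- A shear `P = 1 + u zᵀ` preserves the contraction matrix, because `u` lies in its left and right
kernels, and `z` can be chosen so that `P` carries the row vector `u` to `w`. Then only `det P`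
enters. -/
theorem det_contractionMatrix_add_vecMulVec (u w : Fin 7 → ℝ) (hu : u ≠ 0) :
    (contractionMatrix u + vecMulVec w w).det =
      (w ⬝ᵥ u / u ⬝ᵥ u) ^ 2 * (contractionMatrix u + vecMulVec u u).det := by
  set r := u ⬝ᵥ u with hr
  have h0 : r ≠ 0 := by simpa [hr] using hu
  set z := r⁻¹ • (w - u) with hz
  set P : Matrix (Fin 7) (Fin 7) ℝ := 1 + vecMulVec u z with hP
  have hdet : P.det = w ⬝ᵥ u / r := by
    rw [hP, vecMulVec_eq Unit, det_one_add_replicateCol_mul_replicateRow, hz, smul_dotProduct,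
      sub_dotProduct, ← hr]
    simp
    field_simp
    ring
  have hPu : u ᵥ* P = w := by
    rw [hP, vecMul_add, vecMul_one, vecMul_vecMulVec, ← hr, hz, smul_smul,
      mul_inv_cancel₀ h0, one_smul, add_sub_cancel]
  have hPW : Pᵀ * contractionMatrix u * P = contractionMatrix u := by
    rw [hP, transpose_add, transpose_vecMulVec, transpose_one, add_mul, one_mul, vecMulVec_mul,
      vecMul_contractionMatrix_self, vecMulVec_zero, add_zero, mul_add, mul_one, mul_vecMulVec,
      contractionMatrix_mulVec_self, zero_vecMulVec, add_zero]
  have h : contractionMatrix u + vecMulVec w w =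
      Pᵀ * (contractionMatrix u + vecMulVec u u) * P := by
    rw [mul_add Pᵀ, add_mul, hPW, mul_vecMulVec, vecMulVec_mul, mulVec_transpose, hPu]
  rw [h, det_mul, det_mul, det_transpose, hdet]
  ring

theorem dotProduct_self_pos {u : Fin 7 → ℝ} (hu : u ≠ 0) : 0 < u ⬝ᵥ u :=
  lt_of_le_of_ne (by simpa using dotProduct_star_self_nonneg u)
    (Ne.symm (by simpa using hu))

/-- The quadratic form `u ↦ |θ(u)|² |θ¹²³⁴⁵⁶⁷|`, reconstructed from the matrix of `ι_u φ`. -/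
theorem abs_det_conj_contractionMatrix (T : Matrix (Fin 7) (Fin 7) ℝ) (hT : T.det ≠ 0)
    (u : Fin 7 → ℝ) (hu : u ≠ 0) :
    √|(Tᵀ * contractionMatrix (T *ᵥ u) * T + vecMulVec u u).det| / (u ⬝ᵥ u) =
      |T.det| * ((T *ᵥ u) ⬝ᵥ (T *ᵥ u)) := by
  set v := T *ᵥ u with hv
  have hTu : IsUnit T.det := isUnit_iff_ne_zero.2 hT
  have hv0 : v ≠ 0 := by
    intro h
    refine hu ?_
    have := congrArg (T⁻¹ *ᵥ ·) h
    simpa [hv, mulVec_mulVec, nonsing_inv_mul _ hTu] using this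
  -- The correction `u uᵀ` is made in the coordinates of the basis; in the coordinates of the
  -- coframe it becomes `w wᵀ`, with `w · Tu = u · u`.
  set w := u ᵥ* T⁻¹ with hw
  have hwT : w ᵥ* T = u := by rw [hw, vecMul_vecMul, nonsing_inv_mul _ hTu, vecMul_one]
  have hwv : w ⬝ᵥ v = u ⬝ᵥ u := by rw [hv, dotProduct_mulVec, hwT]
  have h1 : Tᵀ * contractionMatrix v * T + vecMulVec u u =
      Tᵀ * (contractionMatrix v + vecMulVec w w) * T := by
    rw [mul_add, add_mul, mul_vecMulVec, vecMulVec_mul, mulVec_transpose, hwT]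
  have hr : 0 < u ⬝ᵥ u := dotProduct_self_pos hu
  have hq : 0 < v ⬝ᵥ v := dotProduct_self_pos hv0
  rw [h1, det_mul, det_mul, det_transpose, det_contractionMatrix_add_vecMulVec _ _ hv0, hwv,
    abs_mul, abs_mul, abs_mul, abs_det_contractionMatrix_add, div_eq_iff hr.ne',
    Real.sqrt_eq_iff_eq_sq (by positivity) (by positivity),
    abs_of_nonneg (sq_nonneg (u ⬝ᵥ u / v ⬝ᵥ v))]
  field_simp

/-- The contraction of a three-form with `u = ∑ uₐ bₐ`, as a matrix with respect to `b`. -/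
def formMatrix {V : Type*} [AddCommGroup V] [Module ℝ V] [TopologicalSpace V]
    (φ : V [⋀^Fin 3]→L[ℝ] ℝ) (b : Fin 7 → V) (u : Fin 7 → ℝ) : Matrix (Fin 7) (Fin 7) ℝ :=
  Matrix.of fun i j => φ ![∑ a, u a • b a, b i, b j]

/-- The Hitchin quadratic form of a `G₂` three-form, in the coordinates given by `b`. -/
def hitchinQuad {V : Type*} [AddCommGroup V] [Module ℝ V] [TopologicalSpace V]
    (φ : V [⋀^Fin 3]→L[ℝ] ℝ) (b : Fin 7 → V) (u : Fin 7 → ℝ) : ℝ :=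
  √|(formMatrix φ b u + vecMulVec u u).det| / (u ⬝ᵥ u)

/-- The Gram matrix of the Hitchin quadratic form. -/
def hitchinGram {V : Type*} [AddCommGroup V] [Module ℝ V] [TopologicalSpace V]
    (φ : V [⋀^Fin 3]→L[ℝ] ℝ) (b : Fin 7 → V) : Matrix (Fin 7) (Fin 7) ℝ :=
  Matrix.of fun i j => (hitchinQuad φ b (Pi.single i 1 + Pi.single j 1) -
    hitchinQuad φ b (Pi.single i 1) - hitchinQuad φ b (Pi.single j 1)) / 2

section

variable {V : Type*} [AddCommGroup V] [Module ℝ V] [TopologicalSpace V]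

theorem g2Model_apply (θ : Fin 7 → V →L[ℝ] ℝ) (x y z : V) :
    g2Model θ ![x, y, z] =
      (fun i => θ i y) ⬝ᵥ (contractionMatrix (fun i => θ i x) *ᵥ fun i => θ i z) := by
  simp only [g2Model, ContinuousAlternatingMap.add_apply, ContinuousAlternatingMap.sub_apply,
    wedge_apply, Matrix.det_fin_three]
  have h : (-1 : Fin 7) = 6 := rfl
  simp [contractionMatrix, mulVec, dotProduct, Fin.sum_univ_succ, h]
  ring

theorem formMatrix_g2Model (θ : Fin 7 → V →L[ℝ] ℝ) (b : Fin 7 → V) (u : Fin 7 → ℝ) :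
    formMatrix (g2Model θ) b u = (Matrix.of fun i j => θ i (b j))ᵀ *
      contractionMatrix ((Matrix.of fun i j => θ i (b j)) *ᵥ u) *
        (Matrix.of fun i j => θ i (b j)) := by
  ext i j
  rw [Matrix.mul_assoc, Matrix.mul_apply, formMatrix, Matrix.of_apply, g2Model_apply]
  have : (fun i => θ i (∑ a, u a • b a)) = (Matrix.of fun i j => θ i (b j)) *ᵥ u := by
    ext i
    simp [mulVec, dotProduct, mul_comm]
  rw [this]
  rfl

/-- The left side depends on the three-form alone, so this recovers the absolute value of the volume
form from `φ` and a basis. -/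
theorem det_hitchinGram (θ : Fin 7 → V →L[ℝ] ℝ) (b : Fin 7 → V) (h : wedge θ b ≠ 0) :
    (hitchinGram (g2Model θ) b).det = |wedge θ b| ^ 9 := by
  rw [wedge_apply] at h ⊢
  set T : Matrix (Fin 7) (Fin 7) ℝ := Matrix.of fun i j => θ i (b j) with hT
  have hq (u : Fin 7 → ℝ) (hu : u ≠ 0) : hitchinQuad (g2Model θ) b u =
      |T.det| * ((T *ᵥ u) ⬝ᵥ (T *ᵥ u)) := by
    rw [hitchinQuad, formMatrix_g2Model]
    exact abs_det_conj_contractionMatrix T h u hu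
  have hs (i : Fin 7) : (Pi.single i 1 : Fin 7 → ℝ) ≠ 0 := by simp
  -- The formula for `hitchinQuad` holds away from `0`, so the vectors used for polarisation must be
  -- nonzero; for `i = j` the sum is twice a basis vector.
  have hss (i j : Fin 7) : (Pi.single i 1 + Pi.single j 1 : Fin 7 → ℝ) ≠ 0 := fun h0 => by
    have h1 := congrFun h0 i
    by_cases hij : i = j
    · subst hij; norm_num at h1
    · simp [hij] at h1
  have hG : hitchinGram (g2Model θ) b = |T.det| • (Tᵀ * T) := by
    ext i j
    rw [hitchinGram, Matrix.of_apply, hq _ (hss i j), hq _ (hs i), hq _ (hs j), mulVec_add,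
      add_dotProduct, dotProduct_add, dotProduct_add, dotProduct_comm (T *ᵥ Pi.single j 1)
      (T *ᵥ Pi.single i 1), mulVec_single_one, mulVec_single_one, Matrix.smul_apply,
      Matrix.mul_apply', smul_eq_mul]
    have : (T.col i ⬝ᵥ T.col j) = ((fun k => Tᵀ i k) ⬝ᵥ fun k => T k j) := rfl
    rw [← this]
    ring
  -- The exponent is `9 = 7 + 2`: seven from the scalar factor and two from `TᵀT`.
  rw [hG, det_smul, det_mul, det_transpose, Fintype.card_fin, ← abs_mul_abs_self T.det]
  ring

/-- The volume form of a `G₂` three-form does not depend on the coframe. -/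
theorem IsG2Coframe.wedge_eq {ν : V [⋀^Fin 7]→L[ℝ] ℝ} {φ : V [⋀^Fin 3]→L[ℝ] ℝ}
    {θ θ' : Fin 7 → V →L[ℝ] ℝ} (h : IsG2Coframe ν φ θ) (h' : IsG2Coframe ν φ θ') :
    wedge θ = wedge θ' := by
  obtain ⟨⟨r, hr, hν⟩, hφ⟩ := h
  obtain ⟨⟨r', hr', hν'⟩, hφ'⟩ := h'
  ext b
  by_cases h0 : ν b = 0
  · rw [hν, hν']
    simp [h0]
  have h1 : wedge θ b = r * ν b := by rw [hν]; rfl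
  have h2 : wedge θ' b = r' * ν b := by rw [hν']; rfl
  have h3 := det_hitchinGram θ b (by rw [h1]; exact mul_ne_zero hr.ne' h0)
  have h4 := det_hitchinGram θ' b (by rw [h2]; exact mul_ne_zero hr'.ne' h0)
  rw [← hφ'.symm.trans hφ |>.symm, h3] at h4
  -- Ninth powers determine the absolute values, and the common orientation determines the sign.
  have h5 := (pow_left_inj₀ (abs_nonneg _) (abs_nonneg _) (by norm_num)).1 h4
  rw [h1, h2, abs_mul, abs_mul, abs_of_pos hr, abs_of_pos hr'] at h5
  rw [h1, h2, mul_right_cancel₀ (abs_ne_zero.2 h0) h5]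

theorem g2Vol_eq {ν : V [⋀^Fin 7]→L[ℝ] ℝ} {φ : V [⋀^Fin 3]→L[ℝ] ℝ}
    {θ : Fin 7 → V →L[ℝ] ℝ} (h : IsG2Coframe ν φ θ) : g2Vol ν φ = wedge θ := by
  have h' : IsG2 ν φ := ⟨θ, h⟩
  rw [g2Vol, dif_pos h']
  exact IsG2Coframe.wedge_eq h'.choose_spec h

end

end

/-! ### Forms on `N` as deck-invariant forms on the universal covering. -/

theorem exists_mem_target (e : E) : ∃ c ∈ atlas E N, e ∈ c.target :=
  ⟨isLocalHomeomorph_proj.localInverseAt e, ⟨e, rfl⟩,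
    isLocalHomeomorph_proj.self_mem_localInverseAt_target⟩

theorem mdifferentiableAt_proj (e : E) : MDifferentiableAt 𝓘(ℝ, E) 𝓘(ℝ, E) proj e := by
  obtain ⟨c, hc, he⟩ := exists_mem_target e
  rw [← symm_eq_proj hc]
  exact mdifferentiableAt_atlas_symm hc he

/-- The pullback of a form on `N` to the universal covering. -/
def pull {k : ℕ} (ω : Form E N k) (e : E) : E [⋀^Fin k]→L[ℝ] ℝ :=
  (ω (proj e)).compContinuousLinearMap (mfderiv 𝓘(ℝ, E) 𝓘(ℝ, E) proj e)

variable {k : ℕ}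

theorem inChart_eq_pull (ω : Form E N k) {c : OpenPartialHomeomorph N E} (hc : c ∈ atlas E N) :
    inChart ω c = pull ω := by
  funext y
  unfold inChart pull
  rw [symm_eq_proj hc]

theorem isSmooth_iff_contDiff_pull {ω : Form E N k} :
    IsSmooth ω ↔ ContDiff ℝ ((⊤ : ℕ∞) : WithTop ℕ∞) (pull ω) := by
  constructor
  · refine fun h => contDiff_iff_contDiffAt.2 fun e => ?_
    obtain ⟨c, hc, he⟩ := exists_mem_target e
    rw [← inChart_eq_pull ω hc]
    exact (h c hc).contDiffAt (c.open_target.mem_nhds he)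
  · intro h c hc
    rw [inChart_eq_pull ω hc]
    exact h.contDiffOn

theorem mfderiv_proj_deck {δ : H} (hδ : δ ∈ Del) (n : ℤ) (e : E) :
    mfderiv 𝓘(ℝ, E) 𝓘(ℝ, E) proj (deck δ n e) ∘L fderiv ℝ (deck δ n) e =
      (mfderiv 𝓘(ℝ, E) 𝓘(ℝ, E) proj e : E →L[ℝ] E) := by
  have h := mfderiv_comp e (mdifferentiableAt_proj (deck δ n e))
    (((contDiff_deck δ n (k := 1)).differentiable (by simp)).mdifferentiable e)
  have h2 : proj ∘ deck δ n = proj := funext fun e => proj_deck hδ n e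
  rw [h2, mfderiv_eq_fderiv] at h
  exact h.symm

theorem pull_deck (ω : Form E N k) {δ : H} (hδ : δ ∈ Del) (n : ℤ) (e : E) :
    (pull ω (deck δ n e)).compContinuousLinearMap (fderiv ℝ (deck δ n) e) = pull ω e := by
  have h := mfderiv_proj_deck hδ n e
  unfold pull
  rw [← h]
  -- The values of `ω` at the two base points live on different tangent spaces, each of which is `E`
  -- by definition. Quantifying over the base point lets the equality of points be substituted.
  have key : ∀ x, x = proj e → ∀ L : E →L[ℝ] E,
      ((ω x).compContinuousLinearMap L : E [⋀^Fin k]→L[ℝ] ℝ) =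
        (ω (proj e)).compContinuousLinearMap L := by
    rintro x rfl L
    rfl
  exact key _ (proj_deck hδ n e)
    ((mfderiv 𝓘(ℝ, E) 𝓘(ℝ, E) proj (deck δ n e) : E →L[ℝ] E) ∘L fderiv ℝ (deck δ n) e)

theorem mfderiv_proj_chartAt (x : N) :
    (mfderiv 𝓘(ℝ, E) 𝓘(ℝ, E) proj (chartAt E x x) : E →L[ℝ] E) ∘L
      (mfderiv 𝓘(ℝ, E) 𝓘(ℝ, E) (chartAt E x) x : E →L[ℝ] E) = ContinuousLinearMap.id ℝ E := by
  have hc := chart_mem_atlas E x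
  have h := mfderiv_comp x (mdifferentiableAt_proj (chartAt E x x))
    (mdifferentiableAt_atlas hc (mem_chart_source E x))
  have h2 : proj ∘ chartAt E x =ᶠ[nhds x] id := by
    filter_upwards [(chartAt E x).open_source.mem_nhds (mem_chart_source E x)] with y hy
    simp only [Function.comp, id]
    rw [← symm_eq_proj hc, (chartAt E x).left_inv hy]
  rw [h2.mfderiv_eq, mfderiv_id] at h
  exact h.symm

theorem pull_chartAt (ω : Form E N k) (x : N) :
    (pull ω (chartAt E x x)).compContinuousLinearMap
      (mfderiv 𝓘(ℝ, E) 𝓘(ℝ, E) (chartAt E x) x) = ω x := by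
  have hx : proj (chartAt E x x) = x := by
    rw [← symm_eq_proj (chart_mem_atlas E x), (chartAt E x).left_inv (mem_chart_source E x)]
  have h := mfderiv_proj_chartAt x
  have key : ∀ y, y = x → ∀ L : E →L[ℝ] E, L = ContinuousLinearMap.id ℝ E →
      ((ω y).compContinuousLinearMap L : E [⋀^Fin k]→L[ℝ] ℝ) = ω x := by
    rintro y rfl L rfl
    rfl
  exact key _ hx _ h

theorem pull_injective : Function.Injective (pull (k := k)) := fun ω η h => funext fun x => by
  rw [← pull_chartAt ω x, h, pull_chartAt]

theorem fderiv_chart_comp_proj (e : E) : ∃ δ ∈ Del, ∃ n,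
    chartAt E (proj e) (proj e) = deck δ n e ∧
    (mfderiv 𝓘(ℝ, E) 𝓘(ℝ, E) (chartAt E (proj e)) (proj e) : E →L[ℝ] E) ∘L
      (mfderiv 𝓘(ℝ, E) 𝓘(ℝ, E) proj e : E →L[ℝ] E) = fderiv ℝ (deck δ n) e := by
  have hc := chart_mem_atlas E (proj e)
  obtain ⟨δ, hδ, n, hd⟩ := chart_comp_proj hc (mem_chart_source E (proj e))
  refine ⟨δ, hδ, n, hd.self_of_nhds, ?_⟩
  have h := mfderiv_comp e (mdifferentiableAt_atlas hc (mem_chart_source E (proj e)))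
    (mdifferentiableAt_proj e)
  have h2 : mfderiv 𝓘(ℝ, E) 𝓘(ℝ, E) (chartAt E (proj e) ∘ proj) e = fderiv ℝ (deck δ n) e := by
    rw [mfderiv_eq_fderiv]
    exact hd.fderiv_eq
  rw [h2] at h
  exact h.symm

/-- The exterior derivative on `N` is taken in a preferred chart, and that chart composed with
`proj` is locally a deck transformation. The claim is thus naturality of `extDeriv` under deck
transformations together with the invariance of `pull ω`. -/
theorem pull_extD {ω : Form E N k} (h : IsSmooth ω) (e : E) :
    pull (extD ω) e = extDeriv (pull ω) e := by
  obtain ⟨δ, hδ, n, h1, h2⟩ := fderiv_chart_comp_proj e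
  have h3 : pull ω = fun e => (pull ω (deck δ n e)).compContinuousLinearMap
      (fderiv ℝ (deck δ n) e) := funext fun e => (pull_deck ω hδ n e).symm
  rw [h3, extDeriv_pullback ((isSmooth_iff_contDiff_pull.1 h).differentiable (by simp) _)
    (contDiff_deck δ n (k := 2)).contDiffAt (by simp), ← h2, ← h1]
  have h4 := inChart_eq_pull ω (chart_mem_atlas E (proj e))
  rw [← h4]
  rfl

/-! ### Wedge identities and the coordinate expressions of the basic forms. -/

theorem wedge_comp {V W A : Type*} [AddCommGroup V] [Module ℝ V] [TopologicalSpace V]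
    [AddCommGroup W] [Module ℝ W] [TopologicalSpace W]
    [NormedCommRing A] [NormedAlgebra ℝ A] (θ : Fin k → V →L[ℝ] A) (L : W →L[ℝ] V) :
    (wedge θ).compContinuousLinearMap L = wedge fun i => θ i ∘L L := by
  ext v
  simp only [ContinuousAlternatingMap.compContinuousLinearMap_apply, wedge_apply]
  rfl

section

variable {V : Type*} [AddCommGroup V] [Module ℝ V] [TopologicalSpace V]

theorem re_wedge_conj (g : V →L[ℝ] ℝ) (θ : V →L[ℝ] ℂ) :
    Complex.reCLM.compContinuousAlternatingMap
      ((Complex.I / 2) • wedge ![toComplex g, θ, conj θ]) =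
    wedge ![g, Complex.reCLM ∘L θ, Complex.imCLM ∘L θ] := by
  ext v
  simp only [ContinuousLinearMap.compContinuousAlternatingMap_coe, Function.comp_apply,
    ContinuousAlternatingMap.smul_apply, wedge_apply, Matrix.det_fin_three]
  simp [toComplex, conj]
  ring

theorem re_wedge_conj_two (θ : V →L[ℝ] ℂ) :
    Complex.reCLM.compContinuousAlternatingMap ((Complex.I / 2) • wedge ![θ, conj θ]) =
    wedge ![Complex.reCLM ∘L θ, Complex.imCLM ∘L θ] := by
  ext v
  simp only [ContinuousLinearMap.compContinuousAlternatingMap_coe, Function.comp_apply,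
    ContinuousAlternatingMap.smul_apply, wedge_apply, Matrix.det_fin_two]
  simp [conj]
  ring

theorem re_smul_wedge (l : ℂ) (g : V →L[ℝ] ℝ) (θ η : V →L[ℝ] ℂ) :
    Complex.reCLM.compContinuousAlternatingMap (l • wedge ![toComplex g, θ, η]) =
      l.re • (wedge ![g, Complex.reCLM ∘L θ, Complex.reCLM ∘L η] -
        wedge ![g, Complex.imCLM ∘L θ, Complex.imCLM ∘L η]) -
      l.im • (wedge ![g, Complex.reCLM ∘L θ, Complex.imCLM ∘L η] +
        wedge ![g, Complex.imCLM ∘L θ, Complex.reCLM ∘L η]) := by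
  ext v
  simp only [ContinuousLinearMap.compContinuousAlternatingMap_coe, Function.comp_apply,
    ContinuousAlternatingMap.smul_apply, wedge_apply, Matrix.det_fin_three,
    ContinuousAlternatingMap.add_apply, ContinuousAlternatingMap.sub_apply]
  simp [toComplex]
  ring

theorem im_smul_wedge (l : ℂ) (g : V →L[ℝ] ℝ) (θ η : V →L[ℝ] ℂ) :
    Complex.imCLM.compContinuousAlternatingMap (l • wedge ![toComplex g, θ, η]) =
      l.im • (wedge ![g, Complex.reCLM ∘L θ, Complex.reCLM ∘L η] -
        wedge ![g, Complex.imCLM ∘L θ, Complex.imCLM ∘L η]) +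
      l.re • (wedge ![g, Complex.reCLM ∘L θ, Complex.imCLM ∘L η] +
        wedge ![g, Complex.imCLM ∘L θ, Complex.reCLM ∘L η]) := by
  ext v
  simp only [ContinuousLinearMap.compContinuousAlternatingMap_coe, Function.comp_apply,
    ContinuousAlternatingMap.smul_apply, wedge_apply, Matrix.det_fin_three,
    ContinuousAlternatingMap.add_apply, ContinuousAlternatingMap.sub_apply]
  simp [toComplex]
  ring

theorem wedge_re_im_smul (a : ℂ) (g : V →L[ℝ] ℝ) (θ : V →L[ℝ] ℂ) :
    wedge ![g, Complex.reCLM ∘L (a • θ), Complex.imCLM ∘L (a • θ)] =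
      Complex.normSq a • wedge ![g, Complex.reCLM ∘L θ, Complex.imCLM ∘L θ] := by
  ext v
  simp only [ContinuousAlternatingMap.smul_apply, wedge_apply, Matrix.det_fin_three]
  simp [Complex.normSq_apply]
  ring

theorem wedge_re_im_smul_two (a : ℂ) (θ : V →L[ℝ] ℂ) :
    wedge ![Complex.reCLM ∘L (a • θ), Complex.imCLM ∘L (a • θ)] =
      Complex.normSq a • wedge ![Complex.reCLM ∘L θ, Complex.imCLM ∘L θ] := by
  ext v
  simp only [ContinuousAlternatingMap.smul_apply, wedge_apply, Matrix.det_fin_two]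
  simp [Complex.normSq_apply]
  ring

/-- Applied with `a = e^{w¹}` and `b = e^{-w¹}`: this is why `Ω` pulls back to the constant form
`dw² ∧ dw³`. -/
theorem wedge_smul_smul (a b : ℂ) (hab : a * b = 1) (g θ η : V →L[ℝ] ℂ) :
    wedge ![g, a • θ, b • η] = wedge ![g, θ, η] := by
  ext v
  simp only [wedge_apply, Matrix.det_fin_three]
  simp
  linear_combination (g (v 0) * θ (v 1) * η (v 2) - g (v 0) * θ (v 2) * η (v 1)
    - g (v 1) * θ (v 0) * η (v 2) + g (v 1) * θ (v 2) * η (v 0)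
    + g (v 2) * θ (v 0) * η (v 1) - g (v 2) * θ (v 1) * η (v 0)) * hab

end

theorem normSq_exp (z : ℂ) : Complex.normSq (Complex.exp z) = Real.exp (2 * z.re) := by
  rw [Complex.normSq_eq_norm_sq, Complex.norm_exp, ← Real.exp_nat_mul]
  norm_num

/-- The differentials of the real coordinates on `H`. -/
def dx1 : E →L[ℝ] ℝ := Complex.reCLM ∘L dw1
def dy1 : E →L[ℝ] ℝ := Complex.imCLM ∘L dw1
def dx2 : E →L[ℝ] ℝ := Complex.reCLM ∘L dw2
def dy2 : E →L[ℝ] ℝ := Complex.imCLM ∘L dw2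
def dx3 : E →L[ℝ] ℝ := Complex.reCLM ∘L dw3
def dy3 : E →L[ℝ] ℝ := Complex.imCLM ∘L dw3

/-- The real form `L (a θ₀ ∧ ⋯ ∧ θₖ₋₁)` on `N`. -/
def wedgeForm {A : Type*} [NormedCommRing A] [NormedAlgebra ℝ A] {k : ℕ}
    (L : A →L[ℝ] ℝ) (a : A) (θ : (x : N) → Fin k → TangentSpace 𝓘(ℝ, E) x →L[ℝ] A) :
    Form E N k := fun x => L.compContinuousAlternatingMap (a • wedge (θ x))

theorem pull_wedgeForm {A : Type*} [NormedCommRing A] [NormedAlgebra ℝ A] {k : ℕ}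
    (L : A →L[ℝ] ℝ) (a : A) (θ : (x : N) → Fin k → TangentSpace 𝓘(ℝ, E) x →L[ℝ] A) (e : E)
    (η : Fin k → E →L[ℝ] A)
    (h : ∀ i, (θ (proj e) i) ∘L (mfderiv 𝓘(ℝ, E) 𝓘(ℝ, E) proj e) = η i) :
    pull (wedgeForm L a θ) e = L.compContinuousAlternatingMap (a • wedge η) :=
  congrArg (fun w => L.compContinuousAlternatingMap (a • w))
    ((wedge_comp (θ (proj e)) (mfderiv 𝓘(ℝ, E) 𝓘(ℝ, E) proj e)).trans
      (congrArg wedge (funext h)))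

variable {k : ℕ}

theorem pull_add (ω η : Form E N k) (e : E) : pull (ω + η) e = pull ω e + pull η e := rfl
theorem pull_sub (ω η : Form E N k) (e : E) : pull (ω - η) e = pull ω e - pull η e := rfl
theorem pull_smul (r : ℝ) (ω : Form E N k) (e : E) : pull (r • ω) e = r • pull ω e := rfl

theorem g1_proj (e : E) : (g1 (proj e)) ∘L (mfderiv 𝓘(ℝ, E) 𝓘(ℝ, E) proj e) = dx1 := by
  rw [g1, ContinuousLinearMap.comp_assoc, Theta1_proj]
  rfl
theorem g2_proj (e : E) : (g2 (proj e)) ∘L (mfderiv 𝓘(ℝ, E) 𝓘(ℝ, E) proj e) = dy1 := by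
  rw [g2, ContinuousLinearMap.comp_assoc, Theta1_proj]
  rfl

theorem pull_g123 (e : E) : pull g123 e = wedge ![dx1, dy1, dt] := by
  refine (wedge_comp _ _).trans (congrArg wedge ?_)
  funext i
  fin_cases i
  exacts [g1_proj e, g2_proj e, g3_proj e]

theorem pull_g1Omega (e : E) : pull g1Omega e =
    Real.exp (2 * dx1 e) • wedge ![dx1, dx2, dy2] +
      Real.exp (-2 * dx1 e) • wedge ![dx1, dx3, dy3] := by
  have h : g1Omega =
      wedgeForm Complex.reCLM (Complex.I / 2)
        (fun x => ![toComplex (g1 x), Theta2 x, conj (Theta2 x)]) +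
      wedgeForm Complex.reCLM (Complex.I / 2)
        (fun x => ![toComplex (g1 x), Theta3 x, conj (Theta3 x)]) := by
    funext x
    refine ContinuousAlternatingMap.ext fun v => ?_
    simp only [g1Omega, smul_add]
    exact Complex.add_re _ _
  have h2 := pull_wedgeForm Complex.reCLM (Complex.I / 2)
    (fun x => ![toComplex (g1 x), Theta2 x, conj (Theta2 x)]) e
    ![toComplex dx1, coverTheta2 e, conj (coverTheta2 e)] (fun i => by
      fin_cases i
      exacts [congrArg toComplex (g1_proj e), Theta2_proj e, congrArg conj (Theta2_proj e)])
  have h3 := pull_wedgeForm Complex.reCLM (Complex.I / 2)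
    (fun x => ![toComplex (g1 x), Theta3 x, conj (Theta3 x)]) e
    ![toComplex dx1, coverTheta3 e, conj (coverTheta3 e)] (fun i => by
      fin_cases i
      exacts [congrArg toComplex (g1_proj e), Theta3_proj e, congrArg conj (Theta3_proj e)])
  rw [h, pull_add, h2, h3, re_wedge_conj, re_wedge_conj, coverTheta2, coverTheta3,
    wedge_re_im_smul, wedge_re_im_smul, normSq_exp, normSq_exp]
  have h4 : 2 * (-e.1.1).re = -2 * dx1 e := by simp [dx1, dw1]
  rw [h4]
  rfl

/-- The two-form `(i/2) (Θ² ∧ Θ̄² - Θ³ ∧ Θ̄³) / 2` on `N`, a primitive of `g¹ ∧ ω`. -/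
def g1OmegaPrimitive : Form E N 2 :=
  (1 / 2 : ℝ) • (wedgeForm Complex.reCLM (Complex.I / 2) (fun x => ![Theta2 x, conj (Theta2 x)]) -
    wedgeForm Complex.reCLM (Complex.I / 2) (fun x => ![Theta3 x, conj (Theta3 x)]))

theorem pull_g1OmegaPrimitive (e : E) : pull g1OmegaPrimitive e =
    (Real.exp (2 * dx1 e) / 2) • wedge ![dx2, dy2] +
      (-Real.exp (-2 * dx1 e) / 2) • wedge ![dx3, dy3] := by
  have h2 := pull_wedgeForm Complex.reCLM (Complex.I / 2)
    (fun x => ![Theta2 x, conj (Theta2 x)]) e ![coverTheta2 e, conj (coverTheta2 e)] (fun i => by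
      fin_cases i
      exacts [Theta2_proj e, congrArg conj (Theta2_proj e)])
  have h3 := pull_wedgeForm Complex.reCLM (Complex.I / 2)
    (fun x => ![Theta3 x, conj (Theta3 x)]) e ![coverTheta3 e, conj (coverTheta3 e)] (fun i => by
      fin_cases i
      exacts [Theta3_proj e, congrArg conj (Theta3_proj e)])
  rw [g1OmegaPrimitive, pull_smul, pull_sub, h2, h3, re_wedge_conj_two, re_wedge_conj_two,
    coverTheta2, coverTheta3, wedge_re_im_smul_two, wedge_re_im_smul_two, normSq_exp, normSq_exp]
  have h4 : 2 * (-e.1.1).re = -2 * dx1 e := by simp [dx1, dw1]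
  have h5 : 2 * e.1.1.re = 2 * dx1 e := rfl
  have h6 (a b : ℝ) (u w : E [⋀^Fin 2]→L[ℝ] ℝ) :
      (1 / 2 : ℝ) • (a • u - b • w) = (a / 2) • u + (-b / 2) • w := by
    ext v
    simp
    ring
  rw [h4, h5]
  exact h6 _ _ _ _

theorem pull_g2ReOmega (l : ℂ) (e : E) : pull (g2ReOmega l) e =
    Complex.reCLM.compContinuousAlternatingMap (l • wedge ![toComplex dy1, dw2, dw3]) := by
  have h := pull_wedgeForm Complex.reCLM l (fun x => ![toComplex (g2 x), Theta2 x, Theta3 x]) e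
    ![toComplex dy1, coverTheta2 e, coverTheta3 e] (fun i => by
      fin_cases i
      exacts [congrArg toComplex (g2_proj e), Theta2_proj e, Theta3_proj e])
  rw [coverTheta2, coverTheta3, wedge_smul_smul] at h
  · exact h
  · rw [← Complex.exp_add, add_neg_cancel, Complex.exp_zero]

theorem pull_g3ImOmega (l : ℂ) (e : E) : pull (g3ImOmega l) e =
    Complex.imCLM.compContinuousAlternatingMap (l • wedge ![toComplex dt, dw2, dw3]) := by
  have h := pull_wedgeForm Complex.imCLM l (fun x => ![toComplex (g3 x), Theta2 x, Theta3 x]) e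
    ![toComplex dt, coverTheta2 e, coverTheta3 e] (fun i => by
      fin_cases i
      exacts [congrArg toComplex (g3_proj e), Theta2_proj e, Theta3_proj e])
  rw [coverTheta2, coverTheta3, wedge_smul_smul] at h
  · exact h
  · rw [← Complex.exp_add, add_neg_cancel, Complex.exp_zero]

/-! ### Exterior derivatives, closedness, and the exactness of `g¹ ∧ ω`. -/

/-- With constant covectors, the alternating sum that defines `extDeriv` is the Laplace expansion of
the determinant along the row of `f'`. -/
theorem extDeriv_smul_wedge {V : Type*} [NormedAddCommGroup V] [NormedSpace ℝ V] {k : ℕ}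
    {f : V → ℝ} {f' : V →L[ℝ] ℝ} {x : V} (hf : HasFDerivAt f f' x) (θ : Fin k → V →L[ℝ] ℝ) :
    extDeriv (fun y => f y • wedge θ) x = wedge (Matrix.vecCons f' θ) := by
  ext v
  rw [extDeriv_apply (hf.differentiableAt.smul_const _), wedge_apply, Matrix.det_succ_row_zero]
  refine Finset.sum_congr rfl fun i _ => ?_
  have : (fun y => (f y • wedge θ) (i.removeNth v)) = fun y => f y * wedge θ (i.removeNth v) := rfl
  rw [this, (hf.mul_const _).fderiv, wedge_apply]
  simp only [_root_.smul_apply, smul_eq_mul, Matrix.of_apply, Matrix.cons_val_zero,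
    zsmul_eq_mul]
  have h3 : (Matrix.of fun i_1 j => θ i_1 (i.removeNth v j)) =
      (Matrix.of fun i j => Matrix.vecCons f' θ i (v j)).submatrix Fin.succ i.succAbove := rfl
  rw [h3]
  push_cast
  ring

theorem extDeriv_const {V : Type*} [NormedAddCommGroup V] [NormedSpace ℝ V] {k : ℕ}
    (c : V [⋀^Fin k]→L[ℝ] ℝ) (x : V) : extDeriv (fun _ => c) x = 0 := by
  ext v
  rw [extDeriv_apply (differentiableAt_const c)]
  simp

theorem wedge_vecCons_smul {V : Type*} [AddCommGroup V] [Module ℝ V] [TopologicalSpace V]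
    {k : ℕ} (r : ℝ) (g : V →L[ℝ] ℝ)
    (θ : Fin k → V →L[ℝ] ℝ) :
    wedge (Matrix.vecCons (r • g) θ) = r • wedge (Matrix.vecCons g θ) := by
  ext v
  rw [ContinuousAlternatingMap.smul_apply, wedge_apply, wedge_apply, Matrix.det_succ_row_zero,
    Matrix.det_succ_row_zero, Finset.smul_sum]
  refine Finset.sum_congr rfl fun i _ => ?_
  have : (Matrix.of fun i j => Matrix.vecCons (r • g) θ i (v j)).submatrix Fin.succ i.succAbove =
    (Matrix.of fun i j => Matrix.vecCons g θ i (v j)).submatrix Fin.succ i.succAbove := rfl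
  rw [this]
  simp
  ring

theorem hasFDerivAt_exp_dx1 (c : ℝ) (e : E) :
    HasFDerivAt (fun e => Real.exp (c * dx1 e)) ((Real.exp (c * dx1 e) * c) • dx1) e := by
  have h := (dx1.hasFDerivAt (x := e)).const_mul c
  rw [mul_smul]
  exact h.exp

/-- The minus sign in the primitive compensates the sign produced by differentiating `e^{-2x}`, so
both halves of `ω` appear with a plus. -/
theorem extD_g1OmegaPrimitive : IsSmooth g1OmegaPrimitive ∧ extD g1OmegaPrimitive = g1Omega := by
  have hs : IsSmooth g1OmegaPrimitive := by
    rw [isSmooth_iff_contDiff_pull, funext pull_g1OmegaPrimitive]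
    fun_prop
  refine ⟨hs, pull_injective (funext fun e => ?_)⟩
  have h1 : HasFDerivAt (fun e => Real.exp (2 * dx1 e) / 2) (Real.exp (2 * dx1 e) • dx1) e := by
    refine ((hasFDerivAt_exp_dx1 2 e).mul_const (1 / 2)).congr_fderiv ?_ |>.congr_of_eventuallyEq ?_
    · rw [smul_smul]; congr 1; ring
    · exact .of_forall fun x => by ring
  have h2 : HasFDerivAt (fun e => -Real.exp (-2 * dx1 e) / 2) (Real.exp (-2 * dx1 e) • dx1) e := by
    refine ((hasFDerivAt_exp_dx1 (-2) e).mul_const (-1 / 2)).congr_fderiv ?_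
      |>.congr_of_eventuallyEq ?_
    · rw [smul_smul]; congr 1; ring
    · exact .of_forall fun x => by ring
  rw [pull_extD hs, funext pull_g1OmegaPrimitive, extDeriv_fun_add
    (h1.differentiableAt.smul_const _) (h2.differentiableAt.smul_const _), extDeriv_smul_wedge h1,
    extDeriv_smul_wedge h2, pull_g1Omega, wedge_vecCons_smul, wedge_vecCons_smul]

theorem mem_closedForms_of_pull {k : ℕ} {ω : Form E N k}
    (h : ContDiff ℝ ((⊤ : ℕ∞) : WithTop ℕ∞) (pull ω)) (hd : ∀ e, extDeriv (pull ω) e = 0) :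
    ω ∈ closedForms E N k := by
  have hs := isSmooth_iff_contDiff_pull.2 h
  refine ⟨hs, pull_injective (funext fun e => ?_)⟩
  rw [pull_extD hs, hd]
  rfl

theorem mem_closedForms_of_pull_const {k : ℕ} {ω : Form E N k} (c : E [⋀^Fin k]→L[ℝ] ℝ)
    (h : ∀ e, pull ω e = c) : ω ∈ closedForms E N k :=
  mem_closedForms_of_pull (by rw [funext h]; exact contDiff_const)
    fun e => by rw [funext h]; exact extDeriv_const c e

theorem g1Omega_mem_closedForms : g1Omega ∈ closedForms E N 3 := by
  refine mem_closedForms_of_pull (by rw [funext pull_g1Omega]; fun_prop) fun e => ?_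
  rw [← extD_g1OmegaPrimitive.2, funext fun e => pull_extD extD_g1OmegaPrimitive.1 e]
  exact extDeriv_extDeriv_apply (r := ((⊤ : ℕ∞) : WithTop ℕ∞))
    (isSmooth_iff_contDiff_pull.1 extD_g1OmegaPrimitive.1).contDiffAt
    (by rw [minSmoothness_of_isRCLikeNormedField]; exact WithTop.coe_le_coe.2 (le_top : (2 : ℕ∞) ≤ ⊤))

theorem phiScaled_mem_closedForms (p : Params) (μ : ℝ) : phiScaled p μ ∈ closedForms E N 3 :=
  add_mem (sub_mem (add_mem (Submodule.smul_mem _ _ (mem_closedForms_of_pull_const _ pull_g123))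
    (Submodule.smul_mem _ _ g1Omega_mem_closedForms))
      (Submodule.smul_mem _ _ (mem_closedForms_of_pull_const _ (pull_g2ReOmega _))))
    (mem_closedForms_of_pull_const _ (pull_g3ImOmega _))

theorem phiScaled_one (p : Params) : phiScaled p 1 = phi p := by
  simp [phiScaled, phi]

theorem phi_mem_closedForms (p : Params) : phi p ∈ closedForms E N 3 :=
  phiScaled_one p ▸ phiScaled_mem_closedForms p 1

theorem phiScaled_sub_phi_mem_exactForms (p : Params) (μ : ℝ) :
    phiScaled p μ - phi p ∈ exactForms E N 2 := by
  have h : phiScaled p μ - phi p = (p.α * μ ^ 6 - p.α) • g1Omega := by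
    rw [phiScaled, phi, sub_smul]
    abel
  rw [h]
  exact Submodule.smul_mem _ _ ⟨_, extD_g1OmegaPrimitive⟩

theorem deRhamClass_eq_iff {k : ℕ} (ω η : closedForms E N (k + 1)) :
    deRhamClass ω = deRhamClass η ↔ ω.1 - η.1 ∈ exactForms E N k := by
  rw [deRhamClass, deRhamClass, Submodule.Quotient.eq]
  rfl

/-! ### Adapted coframes and the volume form of `φ(α, β, λ; μ)`. -/

section

variable {V : Type*} [AddCommGroup V] [Module ℝ V] [TopologicalSpace V]

/-- The multiple `r θ₀ ∧ ⋯ ∧ θₖ₋₁` of a wedge product. Stating it as a definition of its own makes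
unification compare the factors instead of unfolding the wedge product. -/
def smulWedge {k : ℕ} (r : ℝ) (θ : Fin k → V →L[ℝ] ℝ) : V [⋀^Fin k]→L[ℝ] ℝ := r • wedge θ

theorem smul_wedge_eq (k : ℕ) {_ : ContinuousConstSMul ℝ ℝ} {_ : SMulCommClass ℝ ℝ ℝ}
    {r : ℝ} {θ : Fin k → V →L[ℝ] ℝ} : r • wedge θ = smulWedge r θ := rfl

theorem smulWedge_smul {k : ℕ} (s r : ℝ) (θ : Fin k → V →L[ℝ] ℝ) :
    s • smulWedge r θ = smulWedge (s * r) θ := smul_smul s r (wedge θ)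

theorem wedge_eq_det_smul {k : ℕ} {θ η : Fin k → V →L[ℝ] ℝ} (B : Matrix (Fin k) (Fin k) ℝ)
    (h : ∀ i v, η i v = ∑ j, B i j * θ j v) : wedge η = smulWedge B.det θ := by
  rw [smulWedge]
  ext v
  rw [ContinuousAlternatingMap.smul_apply, wedge_apply, wedge_apply, smul_eq_mul, ← Matrix.det_mul]
  congr 1
  ext i j
  simp [Matrix.mul_apply, h]

/-- A coframe adapted to an `SU(3)`-type coframe `(g¹, g², g³, Re Θ², Im Θ², Re Θ³, Im Θ³)`. -/
def scaledCoframe (g₁ g₂ g₃ : V →L[ℝ] ℝ) (θ η : V →L[ℝ] ℂ) (a b₂ b₃ r : ℝ) (s : ℂ) :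
    Fin 7 → V →L[ℝ] ℝ :=
  ![a • g₁, b₂ • g₂, b₃ • g₃, Complex.reCLM ∘L (r • θ), Complex.imCLM ∘L (r • θ),
    Complex.reCLM ∘L (s • η), Complex.imCLM ∘L (s • η)]

theorem wedge_scaledCoframe (g₁ g₂ g₃ : V →L[ℝ] ℝ) (θ η : V →L[ℝ] ℂ) (a b₂ b₃ r : ℝ) (s : ℂ) :
    wedge (scaledCoframe g₁ g₂ g₃ θ η a b₂ b₃ r s) =
      smulWedge (a * b₂ * b₃ * (r ^ 2 * Complex.normSq s))
        ![g₁, g₂, g₃, Complex.reCLM ∘L θ, Complex.imCLM ∘L θ,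
          Complex.reCLM ∘L η, Complex.imCLM ∘L η] := by
  obtain ⟨B, hBdef⟩ : ∃ B : Matrix (Fin 7) (Fin 7) ℝ, B =
    !![a, 0, 0, 0, 0, 0, 0;
       0, b₂, 0, 0, 0, 0, 0;
       0, 0, b₃, 0, 0, 0, 0;
       0, 0, 0, r, 0, 0, 0;
       0, 0, 0, 0, r, 0, 0;
       0, 0, 0, 0, 0, s.re, -s.im;
       0, 0, 0, 0, 0, s.im, s.re] := ⟨_, rfl⟩
  have hB : B.det = a * b₂ * b₃ * (r ^ 2 * Complex.normSq s) := by
    simp [hBdef, Matrix.det_succ_row_zero, Fin.sum_univ_succ, Complex.normSq_apply, Fin.succAbove]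
    ring
  rw [← hB]
  refine wedge_eq_det_smul B fun i v => ?_
  fin_cases i <;> simp [hBdef, scaledCoframe, Fin.sum_univ_succ] <;> ring

theorem g2Model_scaledCoframe (g₁ g₂ g₃ : V →L[ℝ] ℝ) (θ η : V →L[ℝ] ℂ) (a b₂ b₃ r : ℝ) (s : ℂ) :
    g2Model (scaledCoframe g₁ g₂ g₃ θ η a b₂ b₃ r s) =
      (a * b₂ * b₃) • wedge ![g₁, g₂, g₃] +
      a • (r ^ 2 • wedge ![g₁, Complex.reCLM ∘L θ, Complex.imCLM ∘L θ] +
        Complex.normSq s • wedge ![g₁, Complex.reCLM ∘L η, Complex.imCLM ∘L η]) +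
      b₂ • Complex.reCLM.compContinuousAlternatingMap ((r * s) • wedge ![toComplex g₂, θ, η]) -
      b₃ • Complex.imCLM.compContinuousAlternatingMap ((r * s) • wedge ![toComplex g₃, θ, η]) := by
  have h7 : (-1 : Fin 7) = 6 := rfl
  rw [re_smul_wedge, im_smul_wedge]
  ext v
  simp only [g2Model, ContinuousAlternatingMap.add_apply, ContinuousAlternatingMap.sub_apply,
    ContinuousAlternatingMap.smul_apply, wedge_apply, Matrix.det_fin_three]
  simp [scaledCoframe, h7, Complex.normSq_apply]
  ring

/-- The coframe `(a g₁, b₂ g₂, b₃ g₃, rθ, sη)` is found by matching coefficients: `a b₂ b₃ = αβ`, `a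
r² = a |s|² = α μ⁶`, `b₂ r s = -β λ` and `b₃ r s = -λ`. With `c = |λ|^{1/3}` and `b = c / μ²`, the
solution is `a = α / b²`, `b₂ = -bβ`, `b₃ = -b`, `r = μc`, `s = μλ / c²`. The volume factor relative
to `ν` is `r² |s|² = μ⁴ c⁴`. -/
theorem isG2Coframe_scaledCoframe {ν : V [⋀^Fin 7]→L[ℝ] ℝ} (g₁ g₂ g₃ : V →L[ℝ] ℝ)
    (θ η : V →L[ℝ] ℂ) {α β μ c : ℝ} (hμ : 0 < μ) (hc : 0 < c) {l : ℂ} (hl : ‖l‖ = c ^ 3)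
    (hν : ν = smulWedge (α * β) ![g₁, g₂, g₃, Complex.reCLM ∘L θ, Complex.imCLM ∘L θ,
          Complex.reCLM ∘L η, Complex.imCLM ∘L η]) :
    ∃ ϑ, IsG2Coframe ν ((α * β) • wedge ![g₁, g₂, g₃] +
      (α * μ ^ 6) • (wedge ![g₁, Complex.reCLM ∘L θ, Complex.imCLM ∘L θ] +
        wedge ![g₁, Complex.reCLM ∘L η, Complex.imCLM ∘L η]) -
      β • Complex.reCLM.compContinuousAlternatingMap (l • wedge ![toComplex g₂, θ, η]) +
      Complex.imCLM.compContinuousAlternatingMap (l • wedge ![toComplex g₃, θ, η])) ϑ ∧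
      wedge ϑ = (μ ^ 4 * c ^ 4) • ν := by
  set b := c / μ ^ 2 with hb
  have hb0 : 0 < b := by positivity
  have hl' : Complex.normSq l = c ^ 6 := by
    rw [Complex.normSq_eq_norm_sq, hl]; ring
  have hs : Complex.normSq (((μ / c ^ 2 : ℝ) : ℂ) * l) = (μ * c) ^ 2 := by
    rw [Complex.normSq_mul, Complex.normSq_ofReal, hl']
    field_simp
  have hrs : ((μ * c : ℝ) : ℂ) * (((μ / c ^ 2 : ℝ) : ℂ) * l) = ((1 / b : ℝ) : ℂ) * l := by
    rw [← mul_assoc, ← Complex.ofReal_mul]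
    congr 2
    rw [hb]
    field_simp
  have hw : wedge (scaledCoframe g₁ g₂ g₃ θ η (α / b ^ 2) (-(b * β)) (-b) (μ * c)
      (((μ / c ^ 2 : ℝ) : ℂ) * l)) = (μ ^ 4 * c ^ 4) • ν := by
    rw [wedge_scaledCoframe, hs, hν, smulWedge_smul]
    congr 1
    field_simp
  refine ⟨_, ⟨⟨_, by positivity, hw⟩, ?_⟩, hw⟩
  rw [g2Model_scaledCoframe, hs, hrs, re_smul_wedge, im_smul_wedge, re_smul_wedge, im_smul_wedge]
  have h1 : α / b ^ 2 * -(b * β) * -b = α * β := by field_simp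
  have h2 : α / b ^ 2 * (μ * c) ^ 2 = α * μ ^ 6 := by rw [hb]; field_simp
  ext v
  simp only [ContinuousAlternatingMap.add_apply, ContinuousAlternatingMap.sub_apply,
    ContinuousAlternatingMap.smul_apply, smul_eq_mul, Complex.re_ofReal_mul, Complex.im_ofReal_mul,
    h1, ← h2]
  field_simp
  ring

end

theorem orient_apply (p : Params) (x : N) : orient p x = smulWedge (p.α * p.β)
    ![g1 x, g2 x, g3 x, Complex.reCLM ∘L Theta2 x, Complex.imCLM ∘L Theta2 x,
      Complex.reCLM ∘L Theta3 x, Complex.imCLM ∘L Theta3 x] := by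
  -- The degree 7 is spelled as an iterated successor, the shape in which vector notation produces
  -- the length of the tuple.
  have h := (orient.eq_1 p x).trans (smul_wedge_eq (Nat.succ 0).succ.succ.succ.succ.succ.succ)
  exact h

theorem g1Omega_apply (x : N) : g1Omega x =
    wedge ![g1 x, Complex.reCLM ∘L Theta2 x, Complex.imCLM ∘L Theta2 x] +
      wedge ![g1 x, Complex.reCLM ∘L Theta3 x, Complex.imCLM ∘L Theta3 x] := by
  rw [← re_wedge_conj, ← re_wedge_conj]
  refine ContinuousAlternatingMap.ext fun v => ?_
  simp only [g1Omega, smul_add]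
  exact Complex.add_re _ _

theorem exists_isG2Coframe_phiScaled (p : Params) {μ : ℝ} (hμ : 0 < μ) (x : N) :
    ∃ θ, IsG2Coframe (orient p x) (phiScaled p μ x) θ ∧
      wedge θ = (μ ^ 4 * (‖p.l‖ ^ (1 / 3 : ℝ)) ^ 4) • orient p x := by
  have hl : 0 < ‖p.l‖ := norm_pos_iff.2 p.2.2.ne_zero
  have h := isG2Coframe_scaledCoframe (ν := orient p x) (g1 x) (g2 x) (g3 x) (Theta2 x) (Theta3 x)
    (α := p.α) (β := p.β) hμ (Real.rpow_pos_of_pos hl (1 / 3)) (l := p.l)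
    (by rw [← Real.rpow_natCast, ← Real.rpow_mul hl.le]; norm_num) (orient_apply p x)
  rw [← g1Omega_apply] at h
  exact h

theorem isG2_phiScaled (p : Params) {μ : ℝ} (hμ : 0 < μ) (x : N) :
    IsG2 (orient p x) (phiScaled p μ x) := by
  obtain ⟨θ, h, -⟩ := exists_isG2Coframe_phiScaled p hμ x
  exact ⟨θ, h⟩

theorem volForm_phiScaled (p : Params) {μ : ℝ} (hμ : 0 < μ) :
    volForm (orient p) (phiScaled p μ) =
      (μ ^ 4 * (‖p.l‖ ^ (1 / 3 : ℝ)) ^ 4) • orient p := by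
  funext x
  obtain ⟨θ, h, hw⟩ := exists_isG2Coframe_phiScaled p hμ x
  exact (g2Vol_eq h).trans hw

/-! ### Homogeneity of the measure of a top-degree form and of the Hitchin functional. -/

section

variable {E M : Type*} [NormedAddCommGroup E] [NormedSpace ℝ E] [TopologicalSpace M]
  [ChartedSpace E M] [MeasurableSpace E] [BorelSpace E] [MeasurableSpace M]

theorem chartMeasure_smul {n : ℕ} (b : Module.Basis (Fin n) ℝ E) (τ : Form E M n) {r : ℝ}
    (hr : 0 ≤ r) (c : OpenPartialHomeomorph M E) :
    chartMeasure b (r • τ) c = ENNReal.ofReal r • chartMeasure b τ c := by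
  have h : (fun y => ENNReal.ofReal |inChart (r • τ) c y b|) =
      ENNReal.ofReal r • fun y => ENNReal.ofReal |inChart τ c y b| := by
    funext y
    change ENNReal.ofReal |r * inChart τ c y b| = ENNReal.ofReal r * ENNReal.ofReal _
    rw [abs_mul, abs_of_nonneg hr, ENNReal.ofReal_mul hr]
  rw [chartMeasure, chartMeasure, h, withDensity_smul' _ _ ENNReal.ofReal_ne_top,
    Measure.map_smul]

theorem formMeasure_smul_le {n : ℕ} (b : Module.Basis (Fin n) ℝ E) (τ : Form E M n) {r : ℝ}
    (hr : 0 ≤ r) : formMeasure b (r • τ) ≤ ENNReal.ofReal r • formMeasure b τ := by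
  refine iSup₂_le fun c hc => ?_
  rw [chartMeasure_smul b τ hr]
  have h : chartMeasure b τ c ≤ formMeasure b τ :=
    le_iSup₂ (f := fun c (_ : c ∈ atlas E M) => chartMeasure b τ c) c hc
  gcongr

/-- The reverse inequality is the first one applied to `r • τ` and the factor `r⁻¹`. -/
theorem formMeasure_smul {n : ℕ} (b : Module.Basis (Fin n) ℝ E) (τ : Form E M n) {r : ℝ}
    (hr : 0 < r) : formMeasure b (r • τ) = ENNReal.ofReal r • formMeasure b τ := by
  refine le_antisymm (formMeasure_smul_le b τ hr.le) ?_
  have h := formMeasure_smul_le b (r • τ) (inv_nonneg.2 hr.le)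
  rw [smul_smul, inv_mul_cancel₀ hr.ne', one_smul] at h
  calc ENNReal.ofReal r • formMeasure b τ
      ≤ ENNReal.ofReal r • ENNReal.ofReal r⁻¹ • formMeasure b (r • τ) := by gcongr
    _ = formMeasure b (r • τ) := by
      rw [smul_smul, ← ENNReal.ofReal_mul hr.le, mul_inv_cancel₀ hr.ne', ENNReal.ofReal_one,
        one_smul]

end

theorem hitchin_phiScaled (p : Params) {μ : ℝ} (hμ : 0 < μ) :
    hitchin basisE (orient p) (phiScaled p μ) =
      ENNReal.ofReal (μ ^ 4) * hitchin basisE (orient p) (phi p) := by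
  have hl : 0 < ‖p.l‖ := norm_pos_iff.2 p.2.2.ne_zero
  rw [← phiScaled_one p, hitchin, hitchin, volForm_phiScaled p hμ, volForm_phiScaled p one_pos,
    formMeasure_smul _ _ (by positivity), formMeasure_smul _ _ (by positivity),
    Measure.smul_apply, Measure.smul_apply, smul_eq_mul, smul_eq_mul, ← mul_assoc,
    ← ENNReal.ofReal_mul (by positivity), one_pow, one_mul]

/-! ### Periods over three-tori and injectivity on cohomology. -/

/-- Stokes' theorem on the image in `N` of an affine three-torus: if the translations by the edges
`v i` of a parallelepiped in the universal covering are induced by deck transformations, then an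
exact form which is constant on the parallelepiped vanishes on it. -/
theorem eq_zero_of_exact_of_torus {ω : Form E N 3} (hω : ω ∈ exactForms E N 2) (v : Fin 3 → E)
    (δ : Fin 3 → H) (hδ : ∀ i, δ i ∈ Del) (n : Fin 3 → ℤ)
    (hdeck : ∀ (s : Fin 3 → ℝ) i, deck (δ i) (n i) (∑ j, s j • v j) = ∑ j, s j • v j + v i)
    (hfix : ∀ i j e, fderiv ℝ (deck (δ i) (n i)) e (v j) = v j)
    {c : ℝ} (hc : ∀ s : Fin 3 → ℝ, pull ω (∑ j, s j • v j) v = c) : c = 0 := by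
  obtain ⟨η, hη, rfl⟩ := hω
  let P : (Fin 3 → ℝ) →L[ℝ] E := ∑ j, (ContinuousLinearMap.proj j).smulRight (v j)
  have hP (s : Fin 3 → ℝ) : P s = ∑ j, s j • v j := by
    simp only [P, _root_.sum_apply]
    rfl
  have hPe (i : Fin 3) : P (Pi.single i 1) = v i := by
    rw [hP, Finset.sum_eq_single i (fun j _ hj => by simp [hj]) (by simp)]
    simp
  have hd : Differentiable ℝ (pull η) := (isSmooth_iff_contDiff_pull.1 hη).differentiable (by simp)
  have hdi (i : Fin 3) : Differentiable ℝ fun e => (-1 : ℝ) ^ (i : ℕ) * pull η e (i.removeNth v) :=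
    ((ContinuousAlternatingMap.apply ℝ E ℝ (i.removeNth v)).differentiable.comp hd).const_mul _
  -- The vector field on the unit cube that corresponds to `η`; its divergence is `dη` evaluated on
  -- the edges, that is, the constant `c`.
  let f : Fin 3 → (Fin 3 → ℝ) → ℝ := fun i s => (-1 : ℝ) ^ (i : ℕ) * pull η (P s) (i.removeNth v)
  let f' : Fin 3 → (Fin 3 → ℝ) → (Fin 3 → ℝ) →L[ℝ] ℝ := fun i s =>
    (fderiv ℝ (fun e => (-1 : ℝ) ^ (i : ℕ) * pull η e (i.removeNth v)) (P s)) ∘L P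
  have hf (i : Fin 3) (s) : HasFDerivAt (f i) (f' i s) s :=
    ((hdi i (P s)).hasFDerivAt).comp s P.hasFDerivAt
  have hdiv (s : Fin 3 → ℝ) : ∑ i, f' i s (Pi.single i 1) = c := by
    rw [← hc s, ← hP, pull_extD hη, extDeriv_apply (hd _)]
    refine Finset.sum_congr rfl fun i _ => ?_
    have hi : DifferentiableAt ℝ (fun e => pull η e (i.removeNth v)) (P s) :=
      ((ContinuousAlternatingMap.apply ℝ E ℝ (i.removeNth v)).differentiable.comp hd) _
    simp only [f', ContinuousLinearMap.comp_apply, hPe]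
    rw [fderiv_const_mul hi]
    simp
  have key := integral_divergence_of_hasFDerivAt_off_countable' (0 : Fin 3 → ℝ) 1
    (fun _ => zero_le_one) f f' ∅ Set.countable_empty
    (fun i => (continuous_iff_continuousAt.2 fun s => (hf i s).continuousAt).continuousOn)
    (fun s _ i => hf i s)
    (by simp only [hdiv]; exact continuousOn_const.integrableOn_compact isCompact_Icc)
  simp only [hdiv] at key
  rw [Finset.sum_eq_zero fun i _ => ?_, setIntegral_const] at key
  · simpa [Measure.real, Real.volume_Icc_pi] using key
  rw [sub_eq_zero]
  congr 1
  funext y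
  -- Opposite faces differ by the deck transformation of the `i`-th edge, whose derivative fixes all
  -- edges. As `pull η` is invariant, their fluxes cancel.
  have h1 : P (i.insertNth ((1 : Fin 3 → ℝ) i) y) =
      deck (δ i) (n i) (P (i.insertNth ((0 : Fin 3 → ℝ) i) y)) := by
    rw [hP (i.insertNth ((0 : Fin 3 → ℝ) i) y), hdeck, hP, Fin.sum_univ_succAbove _ i,
      Fin.sum_univ_succAbove _ i]
    simp [add_comm]
  simp only [f, h1]
  rw [← pull_deck η (hδ i) (n i) (P (i.insertNth ((0 : Fin 3 → ℝ) i) y)),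
    ContinuousAlternatingMap.compContinuousLinearMap_apply]
  congr 2
  funext j
  exact (hfix i _ _).symm

theorem fderiv_deck_apply (δ : H) (n : ℤ) (e v : E) : fderiv ℝ (deck δ n) e v =
    ((v.1.1, Complex.exp (-δ.w1) * v.1.2.1, Complex.exp δ.w1 * v.1.2.2), v.2) := by
  rw [(hasFDerivAt_deck δ n e).fderiv]
  rfl

theorem deck_eq_add {δ : H} (hδ : Complex.exp δ.w1 = 1) (n : ℤ) (e : E) :
    deck δ n e = e + ((δ.w1, δ.w2, δ.w3), n * (2 * Real.pi)) := by
  have h : Complex.exp (-δ.w1) = 1 := by rw [Complex.exp_neg, hδ, inv_one]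
  simp only [deck, h, hδ, one_mul]
  rfl

/-- When `e^{w¹} = 1` for each `δ i`, the deck transformations are honest translations of `E`, so
both compatibility conditions on the torus are automatic. -/
theorem eq_zero_of_exact_of_translations {ω : Form E N 3} (hω : ω ∈ exactForms E N 2)
    (δ : Fin 3 → H) (hδ : ∀ i, δ i ∈ Del) (hexp : ∀ i, Complex.exp (δ i).w1 = 1) (n : Fin 3 → ℤ)
    {v : Fin 3 → E} (hv : ∀ i, v i = (((δ i).w1, (δ i).w2, (δ i).w3), n i * (2 * Real.pi)))
    {c : ℝ} (hc : ∀ s : Fin 3 → ℝ, pull ω (∑ j, s j • v j) v = c) : c = 0 := by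
  refine eq_zero_of_exact_of_torus hω v δ hδ n (fun s i => ?_) (fun i j e => ?_) hc
  · rw [deck_eq_add (hexp i), hv i]
  · have h : Complex.exp (-(δ i).w1) = 1 := by rw [Complex.exp_neg, hexp, inv_one]
    rw [fderiv_deck_apply, h, hexp, one_mul, one_mul]

theorem pull_phi (p : Params) (e : E) : pull (phi p) e =
    (p.α * p.β) • wedge ![dx1, dy1, dt] +
      p.α • (Real.exp (2 * dx1 e) • wedge ![dx1, dx2, dy2] +
        Real.exp (-2 * dx1 e) • wedge ![dx1, dx3, dy3]) -
      p.β • Complex.reCLM.compContinuousAlternatingMap (p.l • wedge ![toComplex dy1, dw2, dw3]) +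
      Complex.imCLM.compContinuousAlternatingMap (p.l • wedge ![toComplex dt, dw2, dw3]) := by
  rw [phi, pull_add, pull_sub, pull_add, pull_smul, pull_smul, pull_smul, pull_g123, pull_g1Omega,
    pull_g2ReOmega, pull_g3ImOmega]

open Complex in
theorem ell_mem_Del : (⟨ell, 0, 0⟩ : H) ∈ Del := Subgroup.subset_closure (by simp)
open Complex in
theorem two_pi_I_mem_Del : (⟨2 * Real.pi * I, 0, 0⟩ : H) ∈ Del := Subgroup.subset_closure (by simp)
theorem neg_m_one_mem_Del : (⟨0, -m, 1⟩ : H) ∈ Del := Subgroup.subset_closure (by simp)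
theorem one_m_mem_Del : (⟨0, 1, m⟩ : H) ∈ Del := Subgroup.subset_closure (by simp)
open Complex in
theorem neg_two_pi_I_m_mem_Del :
    (⟨0, -(2 * Real.pi * I * m), 2 * Real.pi * I⟩ : H) ∈ Del := Subgroup.subset_closure (by simp)
open Complex in
theorem two_pi_I_m_mem_Del : (⟨0, 2 * Real.pi * I, 2 * Real.pi * I * m⟩ : H) ∈ Del :=
  Subgroup.subset_closure (by simp)

/-- The torus is `w² = w³ = 0`. The transformation by `ℓ` is not a translation of `E`, but it is one
along this subspace, where only `g¹²³` survives. -/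
theorem alpha_mul_beta_eq {p p' : Params} (h : phi p - phi p' ∈ exactForms E N 2) :
     p.α * p.β = p'.α * p'.β := by
  have := eq_zero_of_exact_of_torus h
    ![((ell, 0, 0), 0), ((2 * Real.pi * Complex.I, 0, 0), 0), ((0, 0, 0), 2 * Real.pi)]
    ![⟨ell, 0, 0⟩, ⟨2 * Real.pi * Complex.I, 0, 0⟩, 1]
    (by intro i; fin_cases i; exacts [ell_mem_Del, two_pi_I_mem_Del, one_mem _]) ![0, 0, 1]
    (fun s i => by
      fin_cases i <;> simp [deck, Fin.sum_univ_three])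
    (fun i j e => by
      rw [fderiv_deck_apply]
      fin_cases i <;> fin_cases j <;> simp)
    (c := (p.α * p.β - p'.α * p'.β) * (4 * Real.pi ^ 2 * ell)) (fun s => by
      rw [pull_sub, pull_phi, pull_phi]
      simp only [ContinuousAlternatingMap.add_apply, ContinuousAlternatingMap.sub_apply,
        ContinuousAlternatingMap.smul_apply, wedge_apply, Matrix.det_fin_three,
        ContinuousLinearMap.compContinuousAlternatingMap_coe, Function.comp_apply]
      simp [dx1, dy1, dt, dx2, dy2, dx3, dy3, dw1, dw2, dw3, toComplex]
      ring)
  have h2 : (4 * Real.pi ^ 2 * ell) ≠ 0 := by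
    have := ell_pos
    positivity
  exact sub_eq_zero.1 ((mul_eq_zero.1 this).resolve_right h2)

/-- The torus is the circle factor times a two-torus in a fibre of `X`; `dw² ∧ dw³` takes the value
`-z (1 + m²)` on its two fibre edges, and `g¹` vanishes on it. -/
theorem im_period {p p' : Params} (h : phi p - phi p' ∈ exactForms E N 2)
    {z : ℂ} (hz : (⟨0, z, z * m⟩ : H) ∈ Del) : (p.l * z).im = (p'.l * z).im := by
  have := eq_zero_of_exact_of_translations h ![1, ⟨0, -m, 1⟩, ⟨0, z, z * m⟩]
    (by intro i; fin_cases i; exacts [one_mem _, neg_m_one_mem_Del, hz])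
    (by intro i; fin_cases i <;> simp) ![1, 0, 0]
    (v := ![((0, 0, 0), 2 * Real.pi), ((0, -m, 1), 0), ((0, z, z * m), 0)])
    (by intro i; fin_cases i <;> simp)
    (c := ((p'.l * z).im - (p.l * z).im) * (2 * Real.pi * (1 + m ^ 2))) (fun s => by
      rw [pull_sub, pull_phi, pull_phi]
      simp only [ContinuousAlternatingMap.add_apply, ContinuousAlternatingMap.sub_apply,
        ContinuousAlternatingMap.smul_apply, wedge_apply, Matrix.det_fin_three,
        ContinuousLinearMap.compContinuousAlternatingMap_coe, Function.comp_apply]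
      simp [dx1, dy1, dt, dx2, dy2, dx3, dy3, dw1, dw2, dw3, toComplex]
      ring)
  have h2 : (2 * Real.pi * (1 + m ^ 2)) ≠ 0 := by positivity
  exact (sub_eq_zero.1 ((mul_eq_zero.1 this).resolve_right h2)).symm

/-- The same fibre torus, with the circle factor replaced by the loop `2πi` in the base, so that
`g²` takes the place of `g³`. -/
theorem re_period {p p' : Params} (h : phi p - phi p' ∈ exactForms E N 2)
    {z : ℂ} (hz : (⟨0, z, z * m⟩ : H) ∈ Del) :
    p.β * (p.l * z).re = p'.β * (p'.l * z).re := by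
  have := eq_zero_of_exact_of_translations h
    ![⟨2 * Real.pi * Complex.I, 0, 0⟩, ⟨0, -m, 1⟩, ⟨0, z, z * m⟩]
    (by intro i; fin_cases i; exacts [two_pi_I_mem_Del, neg_m_one_mem_Del, hz])
    (by intro i; fin_cases i <;> simp [Complex.exp_two_pi_mul_I]) ![0, 0, 0]
    (v := ![((2 * Real.pi * Complex.I, 0, 0), 0), ((0, -m, 1), 0), ((0, z, z * m), 0)])
    (by intro i; fin_cases i <;> simp)
    (c := (p.β * (p.l * z).re - p'.β * (p'.l * z).re) * (2 * Real.pi * (1 + m ^ 2))) (fun s => by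
      rw [pull_sub, pull_phi, pull_phi]
      simp only [ContinuousAlternatingMap.add_apply, ContinuousAlternatingMap.sub_apply,
        ContinuousAlternatingMap.smul_apply, wedge_apply, Matrix.det_fin_three,
        ContinuousLinearMap.compContinuousAlternatingMap_coe, Function.comp_apply]
      simp [dx1, dy1, dt, dx2, dy2, dx3, dy3, dw1, dw2, dw3, toComplex]
      ring)
  have h2 : (2 * Real.pi * (1 + m ^ 2)) ≠ 0 := by positivity
  exact sub_eq_zero.1 ((mul_eq_zero.1 this).resolve_right h2)

theorem params_eq {p p' : Params} (h : phi p - phi p' ∈ exactForms E N 2) :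
     p = p' := by
  have h1 : (⟨0, 1, 1 * m⟩ : H) ∈ Del := by simpa using one_m_mem_Del
  have h2 := two_pi_I_m_mem_Del
  have hπ : 2 * Real.pi ≠ 0 := by positivity
  -- The choice `z = 1` gives the imaginary part of `λ` and `z = 2πi` its real part; in `re_period`
  -- the roles are exchanged and the parts are weighted by `β`.
  have him := im_period h h1
  have hre := im_period h h2
  have him' := re_period h h2
  have hre' := re_period h h1
  simp only [mul_one] at him hre'
  have hc (l : ℂ) : (l * (2 * Real.pi * Complex.I)).im = l.re * (2 * Real.pi) := by simp
  have hc' (l : ℂ) : (l * (2 * Real.pi * Complex.I)).re = -l.im * (2 * Real.pi) := by simp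
  rw [hc, hc] at hre
  rw [hc', hc'] at him'
  have hl : p.l = p'.l := Complex.ext (mul_right_cancel₀ hπ hre) him
  rw [← hl] at hre' him'
  have hβ : p.β = p'.β := by
    rw [← mul_assoc p.β, ← mul_assoc p'.β] at him'
    have h3 := mul_right_cancel₀ hπ him'
    have h4 : (p.β - p'.β) * p.l.re = 0 := by linarith
    have h5 : (p.β - p'.β) * p.l.im = 0 := by linarith
    by_contra hne
    have h6 := sub_ne_zero.2 hne
    exact p.2.2.ne_zero (Complex.ext ((mul_eq_zero.1 h4).resolve_left h6)
      ((mul_eq_zero.1 h5).resolve_left h6))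
  have hα : p.α = p'.α := by
    have h3 := alpha_mul_beta_eq h
    rw [← hβ] at h3
    exact mul_right_cancel₀ p.2.1.ne_zero h3
  exact Prod.ext (Units.ext hα) (Prod.ext (Units.ext hβ) (Units.ext hl))

/-! ### Cocompactness: a ball of the universal covering projects onto `N`. -/

theorem exists_Zt_add_norm_le (z : ℂ) : ∃ x, Zt x ∧ ‖z + x‖ ≤ 5 := by
  have hπ := Real.pi_pos
  refine ⟨((-round z.re : ℤ) : ℂ) + ((-round (z.im / (2 * Real.pi)) : ℤ) : ℂ) *
    (2 * (Real.pi : ℂ) * Complex.I), ⟨_, _, rfl⟩, ?_⟩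
  refine (Complex.norm_le_abs_re_add_abs_im _).trans ?_
  have h1 := abs_sub_round z.re
  have h2 := abs_sub_round (z.im / (2 * Real.pi))
  have h3 : z.im - round (z.im / (2 * Real.pi)) * (2 * Real.pi) =
      (z.im / (2 * Real.pi) - round (z.im / (2 * Real.pi))) * (2 * Real.pi) := by
    field_simp
  have h4 : |z.im - round (z.im / (2 * Real.pi)) * (2 * Real.pi)| ≤ 1 / 2 * (2 * Real.pi) := by
    rw [h3, abs_mul, abs_of_pos (by positivity : 0 < 2 * Real.pi)]
    gcongr
  have h5 := Real.pi_lt_four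
  have h6 : (z + (((-round z.re : ℤ) : ℂ) + ((-round (z.im / (2 * Real.pi)) : ℤ) : ℂ) *
    (2 * (Real.pi : ℂ) * Complex.I))).re = z.re - round z.re := by
    simp
    ring
  have h7 : (z + (((-round z.re : ℤ) : ℂ) + ((-round (z.im / (2 * Real.pi)) : ℤ) : ℂ) *
    (2 * (Real.pi : ℂ) * Complex.I))).im =
      z.im - round (z.im / (2 * Real.pi)) * (2 * Real.pi) := by
    simp
    ring
  rw [h6, h7]
  linarith

/-- The additive group of those `z` for which `(z, 0, 0)` lies in `Δ`. -/
def baseTranslations : AddSubgroup ℂ where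
  carrier := {z | (⟨z, 0, 0⟩ : H) ∈ Del}
  zero_mem' := one_mem Del
  add_mem' := fun {z w} hz hw => by
    have := Del.mul_mem (x := ⟨z, 0, 0⟩) (y := ⟨w, 0, 0⟩) hz hw
    rwa [show (⟨z, 0, 0⟩ : H) * ⟨w, 0, 0⟩ = ⟨z + w, 0, 0⟩ by ext <;> simp] at this
  neg_mem' := fun {z} hz => by
    have := Del.inv_mem (x := ⟨z, 0, 0⟩) hz
    rwa [show (⟨z, 0, 0⟩ : H)⁻¹ = ⟨-z, 0, 0⟩ by ext <;> simp] at this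

/-- The additive group of those `q` for which `(0, q)` lies in `Δ`. -/
def fibreTranslations : AddSubgroup (ℂ × ℂ) where
  carrier := {q | (⟨0, q.1, q.2⟩ : H) ∈ Del}
  zero_mem' := one_mem Del
  add_mem' := fun {z w} hz hw => by
    have := Del.mul_mem (x := ⟨0, z.1, z.2⟩) (y := ⟨0, w.1, w.2⟩) hz hw
    rwa [show (⟨0, z.1, z.2⟩ : H) * ⟨0, w.1, w.2⟩ = ⟨0, (z + w).1, (z + w).2⟩ by
      ext <;> simp] at this
  neg_mem' := fun {z} hz => by
    have := Del.inv_mem (x := ⟨0, z.1, z.2⟩) hz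
    rwa [show (⟨0, z.1, z.2⟩ : H)⁻¹ = ⟨0, (-z).1, (-z).2⟩ by ext <;> simp] at this

theorem exists_base_mem_Del (z : ℂ) : ∃ w, (⟨w, 0, 0⟩ : H) ∈ Del ∧ ‖z + w‖ ≤ ell + 4 := by
  have hπ := Real.pi_pos
  have hl := ell_pos
  have h1 := abs_sub_round (z.re / ell)
  have h2 := abs_sub_round (z.im / (2 * Real.pi))
  set a := round (z.re / ell)
  set b := round (z.im / (2 * Real.pi))
  refine ⟨(-a) • (ell : ℂ) + (-b) • (2 * Real.pi * Complex.I), ?_, ?_⟩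
  · exact baseTranslations.add_mem (baseTranslations.zsmul_mem ell_mem_Del _)
      (baseTranslations.zsmul_mem two_pi_I_mem_Del _)
  refine (Complex.norm_le_abs_re_add_abs_im _).trans ?_
  have h3 : z.re - a * ell = (z.re / ell - a) * ell := by field_simp
  have h4 : z.im - b * (2 * Real.pi) = (z.im / (2 * Real.pi) - b) * (2 * Real.pi) := by
    field_simp
  have h5 : |z.re - a * ell| ≤ 1 / 2 * ell := by
    rw [h3, abs_mul, abs_of_pos hl]
    gcongr
  have h6 : |z.im - b * (2 * Real.pi)| ≤ 1 / 2 * (2 * Real.pi) := by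
    rw [h4, abs_mul, abs_of_pos (by positivity : 0 < 2 * Real.pi)]
    gcongr
  have h7 : (z + ((-a) • (ell : ℂ) + (-b) • (2 * Real.pi * Complex.I))).re = z.re - a * ell := by
    simp
    ring
  have h8 : (z + ((-a) • (ell : ℂ) + (-b) • (2 * Real.pi * Complex.I))).im =
      z.im - b * (2 * Real.pi) := by
    simp
    ring
  rw [h7, h8]
  linarith [Real.pi_lt_four]

theorem fibre_mem_Del {x y : ℂ} (hx : Zt x) (hy : Zt y) :
    (⟨0, -m * x + y, x + m * y⟩ : H) ∈ Del := by
  obtain ⟨c, d, rfl⟩ := hx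
  obtain ⟨c', d', rfl⟩ := hy
  have h := fibreTranslations.add_mem (fibreTranslations.add_mem
    (fibreTranslations.zsmul_mem
      (x := (-m, 1)) neg_m_one_mem_Del c)
    (fibreTranslations.zsmul_mem
      (x := (-(2 * Real.pi * Complex.I * m), 2 * Real.pi * Complex.I)) neg_two_pi_I_m_mem_Del d)) (fibreTranslations.add_mem
    (fibreTranslations.zsmul_mem
      (x := (1, m)) one_m_mem_Del c')
    (fibreTranslations.zsmul_mem
      (x := (2 * Real.pi * Complex.I, 2 * Real.pi * Complex.I * m)) two_pi_I_m_mem_Del d'))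
  change ((-m * (c + d * (2 * Real.pi * Complex.I)) + (c' + d' * (2 * Real.pi * Complex.I)),
    (c + d * (2 * Real.pi * Complex.I)) + m * (c' + d' * (2 * Real.pi * Complex.I))) : ℂ × ℂ) ∈
      fibreTranslations
  convert h using 1
  ext1
  · simp
    ring
  · simp
    ring

theorem m_lt_one : m < 1 := by
  nlinarith [m_sq, m_pos]

/-- A radius such that the ball in the universal covering projects onto `N`. -/
def coverRadius : ℝ := ell + 20

theorem exists_deck_mem_ball (e : E) :
    ∃ δ ∈ Del, ∃ n, deck δ n e ∈ Metric.ball (0 : E) coverRadius := by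
  suffices h : ∃ e' ∈ Metric.ball (0 : E) coverRadius, proj e = proj e' by
    obtain ⟨e', he', h⟩ := h
    obtain ⟨δ, hδ, n, rfl⟩ := exists_deck h
    exact ⟨δ, hδ, n, he'⟩
  have hl := ell_pos
  obtain ⟨z, hz, hz'⟩ := exists_base_mem_Del e.1.1
  -- The base coordinate is reduced first: this rescales the fibre coordinates, whereas the later
  -- fibre translations leave the base coordinate alone.
  obtain ⟨e₁, he₁, hp₁⟩ : ∃ e₁ : E, ‖e₁.1.1‖ ≤ ell + 4 ∧ proj e₁ = proj e :=
    ⟨deck ⟨z, 0, 0⟩ 0 e, hz', proj_deck hz 0 e⟩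
  have hne : (1 + (m : ℂ) ^ 2) ≠ 0 := by
    have : (1 + m ^ 2 : ℝ) ≠ 0 := by positivity
    exact_mod_cast this
  obtain ⟨x, hx, hxn⟩ := exists_Zt_add_norm_le ((e₁.1.2.2 - m * e₁.1.2.1) / (1 + (m : ℂ) ^ 2))
  obtain ⟨y, hy, hyn⟩ := exists_Zt_add_norm_le ((e₁.1.2.1 + m * e₁.1.2.2) / (1 + (m : ℂ) ^ 2))
  -- `X` and `Y` solve `w² = -mX + Y`, `w³ = X + mY`. In these coordinates the fibre translations
  -- are by pairs from `ℤ + 2πiℤ`, and each coordinate can be brought to norm at most 5.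
  set X := (e₁.1.2.2 - m * e₁.1.2.1) / (1 + (m : ℂ) ^ 2) with hX
  set Y := (e₁.1.2.1 + m * e₁.1.2.2) / (1 + (m : ℂ) ^ 2) with hY
  have h2 : e₁.1.2.1 + (-m * x + y) = -(m * (X + x)) + (Y + y) := by
    rw [hX, hY]
    field_simp
    ring
  have h3 : e₁.1.2.2 + (x + m * y) = (X + x) + m * (Y + y) := by
    rw [hX, hY]
    field_simp
    ring
  have hm : ‖(m : ℂ)‖ ≤ 1 := by
    rw [Complex.norm_real, Real.norm_of_nonneg m_pos.le]
    exact m_lt_one.le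
  have hmul (w : ℂ) : ‖(m : ℂ) * w‖ ≤ ‖w‖ := by
    rw [norm_mul]
    exact mul_le_of_le_one_left (norm_nonneg _) hm
  have ht := abs_sub_round (e₁.2 / (2 * Real.pi))
  refine ⟨deck ⟨0, -m * x + y, x + m * y⟩ (-round (e₁.2 / (2 * Real.pi))) e₁, ?_, ?_⟩
  · rw [mem_ball_zero_iff, deck_eq_add (by simp), coverRadius]
    simp only [Prod.norm_def, Prod.fst_add, Prod.snd_add, add_zero, h2, h3, max_lt_iff]
    refine ⟨⟨by linarith, ?_, ?_⟩, ?_⟩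
    · have := norm_add_le (-(m * (X + x))) (Y + y)
      rw [norm_neg] at this
      linarith [hmul (X + x)]
    · linarith [norm_add_le (X + x) (m * (Y + y)), hmul (Y + y)]
    · have hπ := Real.pi_pos
      have h4 : e₁.2 + ((-round (e₁.2 / (2 * Real.pi)) : ℤ) : ℝ) * (2 * Real.pi) =
          (e₁.2 / (2 * Real.pi) - round (e₁.2 / (2 * Real.pi))) * (2 * Real.pi) := by
        push_cast
        field_simp
        ring
      rw [h4, Real.norm_eq_abs, abs_mul, abs_of_pos (by positivity : 0 < 2 * Real.pi)]
      have h5 : |e₁.2 / (2 * Real.pi) - round (e₁.2 / (2 * Real.pi))| * (2 * Real.pi) ≤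
        1 / 2 * (2 * Real.pi) := by gcongr
      linarith [Real.pi_lt_four]
  · rw [proj_deck (fibre_mem_Del hx hy), hp₁]

/-! ### Finiteness and positivity of the total mass. -/

theorem alternatingMap_basis_comp {ι V : Type*} [Fintype ι] [DecidableEq ι]
    [AddCommGroup V] [Module ℝ V] (b : Module.Basis ι ℝ V) (A : V [⋀^ι]→ₗ[ℝ] ℝ) (f : V →ₗ[ℝ] V) :
    A (f ∘ b) = LinearMap.det f * A b := by
  rw [A.eq_smul_basis_det b]
  simp [Module.Basis.det_comp]
  ring

theorem det_mul_pull_deck (τ : Form E N 7) {δ : H} (hδ : δ ∈ Del) (n : ℤ) (e : E) :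
    (fderiv ℝ (deck δ n) e).det * pull τ (deck δ n e) basisE = pull τ e basisE := by
  rw [← pull_deck τ hδ n e]
  exact (alternatingMap_basis_comp basisE (pull τ (deck δ n e)).toAlternatingMap
    (fderiv ℝ (deck δ n) e).toLinearMap).symm

theorem setLIntegral_image_deck (τ : Form E N 7) {δ : H} (hδ : δ ∈ Del) (n : ℤ) {s : Set E}
    (hs : MeasurableSet s) (hinj : Set.InjOn (deck δ n) s) :
    ∫⁻ e in deck δ n '' s, ENNReal.ofReal |pull τ e basisE| ∂basisE.addHaar =
      ∫⁻ e in s, ENNReal.ofReal |pull τ e basisE| ∂basisE.addHaar := by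
  rw [lintegral_image_eq_lintegral_abs_det_fderiv_mul _ hs
    (fun e _ => (((contDiff_deck δ n (k := 1)).differentiable (by simp) e).hasFDerivAt
      ).hasFDerivWithinAt) hinj]
  refine lintegral_congr fun e => ?_
  rw [← ENNReal.ofReal_mul (abs_nonneg _), ← abs_mul, det_mul_pull_deck τ hδ]

/-- Cut `s` into countably many pieces, each of which some deck transformation moves into the ball.
This preserves the mass of each piece, and injectivity of `proj` on `s` keeps the moved pieces
disjoint, so together they fit into the ball. -/
theorem setLIntegral_le_of_injOn_proj (τ : Form E N 7) {A : Set N} {s : Set E}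
    (hs : MeasurableSet s) (hsA : s ⊆ proj ⁻¹' A) (hinj : Set.InjOn proj s) :
    ∫⁻ e in s, ENNReal.ofReal |pull τ e basisE| ∂basisE.addHaar ≤
      ∫⁻ e in Metric.ball 0 coverRadius ∩ proj ⁻¹' A,
        ENNReal.ofReal |pull τ e basisE| ∂basisE.addHaar := by
  let O : Del × ℤ → Set E := fun g => deck g.1 g.2 ⁻¹' Metric.ball 0 coverRadius
  have hcont (g : Del × ℤ) : Continuous (deck g.1 g.2) := (contDiff_deck g.1 g.2 (k := 0)).continuous
  -- The Lindelöf property of `E` reduces to countably many deck transformations, so that countable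
  -- additivity applies.
  obtain ⟨T, hT, hTO⟩ := TopologicalSpace.isOpen_iUnion_countable O
    fun g => Metric.isOpen_ball.preimage (hcont g)
  have hO : ⋃ g ∈ T, O g = Set.univ := by
    rw [hTO]
    refine Set.eq_univ_of_forall fun e => ?_
    obtain ⟨δ, hδ, n, h⟩ := exists_deck_mem_ball e
    exact Set.mem_iUnion.2 ⟨(⟨δ, hδ⟩, n), h⟩
  have hTne : T.Nonempty := by
    by_contra h
    rw [Set.not_nonempty_iff_eq_empty] at h
    simp [h] at hO
    exact (Set.univ_nonempty (α := E)).ne_empty hO.symm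
  obtain ⟨g, rfl⟩ := hT.exists_eq_range hTne
  let t : ℕ → Set E := fun k => s ∩ disjointed (fun k => O (g k)) k
  have hinj_deck (k : ℕ) : Set.InjOn (deck (g k).1 (g k).2) (t k) := fun x hx y hy h =>
    hinj hx.1 hy.1 (by
      rw [← proj_deck (g k).1.2 (g k).2 x, h, proj_deck (g k).1.2])
  have ht (k : ℕ) : MeasurableSet (t k) := hs.inter
    (MeasurableSet.disjointed (fun k => (Metric.isOpen_ball.preimage (hcont (g k))).measurableSet) k)
  have hts : s = ⋃ k, t k := by
    rw [← Set.inter_iUnion, iUnion_disjointed]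
    rw [Set.biUnion_range] at hO
    rw [hO, Set.inter_univ]
  have htd : Pairwise (Function.onFun Disjoint t) := fun i j hij =>
    ((disjoint_disjointed _) hij).mono Set.inter_subset_right Set.inter_subset_right
  have himage (k : ℕ) : MeasurableSet (deck (g k).1 (g k).2 '' t k) :=
    measurable_image_of_fderivWithin (ht k)
      (fun e _ => (((contDiff_deck (g k).1 (g k).2 (k := 1)).differentiable (by simp) e).hasFDerivAt
      ).hasFDerivWithinAt) (hinj_deck k)
  have himd : Pairwise (Function.onFun Disjoint fun k => deck (g k).1 (g k).2 '' t k) := by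
    intro i j hij
    rw [Function.onFun, Set.disjoint_left]
    rintro _ ⟨x, hx, rfl⟩ ⟨y, hy, hxy⟩
    have h1 : x = y := hinj hx.1 hy.1 (by
      rw [← proj_deck (g i).1.2 (g i).2 x, ← hxy, proj_deck (g j).1.2])
    subst h1
    exact Set.disjoint_left.1 (htd hij) hx hy
  conv_lhs => rw [hts, lintegral_iUnion ht htd]
  calc _ = ∑' k, ∫⁻ e in deck (g k).1 (g k).2 '' t k,
        ENNReal.ofReal |pull τ e basisE| ∂basisE.addHaar :=
      tsum_congr fun k => (setLIntegral_image_deck τ (g k).1.2 _ (ht k) (hinj_deck k)).symm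
    _ = ∫⁻ e in ⋃ k, deck (g k).1 (g k).2 '' t k,
        ENNReal.ofReal |pull τ e basisE| ∂basisE.addHaar := (lintegral_iUnion himage himd _).symm
    _ ≤ _ := by
      refine lintegral_mono_set (Set.iUnion_subset fun k => ?_)
      rintro _ ⟨x, hx, rfl⟩
      have h := disjointed_subset (fun k => O (g k)) k hx.2
      refine ⟨h, ?_⟩
      rw [Set.mem_preimage, proj_deck (g k).1.2]
      exact hsA hx.1

theorem continuous_proj : Continuous proj := isLocalHomeomorph_proj.continuous

theorem chartMeasure_apply (τ : Form E N 7) {c : OpenPartialHomeomorph N E} (hc : c ∈ atlas E N)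
    {A : Set N} (hA : MeasurableSet A) : chartMeasure basisE τ c A =
      ∫⁻ e in proj ⁻¹' A ∩ c.target, ENNReal.ofReal |pull τ e basisE| ∂basisE.addHaar := by
  have hA' := continuous_proj.measurable hA
  rw [chartMeasure, symm_eq_proj hc, inChart_eq_pull τ hc, Measure.map_apply
    continuous_proj.measurable hA, withDensity_apply _ hA', Measure.restrict_restrict hA']

theorem formMeasure_univ_le (τ : Form E N 7) : formMeasure basisE τ Set.univ ≤
    ∫⁻ e in Metric.ball 0 coverRadius, ENNReal.ofReal |pull τ e basisE| ∂basisE.addHaar := by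
  -- A supremum of measures is not computed set by set, so each chart measure is bounded as a
  -- measure by one common pushforward, not just on the whole space.
  have h : formMeasure basisE τ ≤ ((basisE.addHaar.restrict (Metric.ball 0 coverRadius)).withDensity
      fun e => ENNReal.ofReal |pull τ e basisE|).map proj := by
    refine iSup₂_le fun c hc => Measure.le_iff.2 fun A hA => ?_
    have hA' := continuous_proj.measurable hA
    rw [chartMeasure_apply τ hc hA, Measure.map_apply continuous_proj.measurable hA,
      withDensity_apply _ hA', Measure.restrict_restrict hA', Set.inter_comm (proj ⁻¹' A)
      (Metric.ball 0 coverRadius)]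
    refine setLIntegral_le_of_injOn_proj τ (hA'.inter c.open_target.measurableSet)
      Set.inter_subset_left ?_
    rw [← symm_eq_proj hc]
    exact c.symm.injOn.mono Set.inter_subset_right
  refine (h _).trans_eq ?_
  rw [Measure.map_apply continuous_proj.measurable MeasurableSet.univ, Set.preimage_univ,
    withDensity_apply _ MeasurableSet.univ, Measure.restrict_univ]

theorem formMeasure_univ_lt_top {τ : Form E N 7} (hτ : Continuous fun e => |pull τ e basisE|) :
    formMeasure basisE τ Set.univ < ⊤ := by
  refine (formMeasure_univ_le τ).trans_lt
    ((lintegral_mono_set Metric.ball_subset_closedBall).trans_lt ?_)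
  have h := (hτ.continuousOn.integrableOn_compact (μ := basisE.addHaar)
    (isCompact_closedBall (0 : E) coverRadius)).2
  rw [hasFiniteIntegral_iff_enorm] at h
  simpa [Real.enorm_eq_ofReal_abs] using h

theorem formMeasure_univ_pos {τ : Form E N 7} (hτ : Continuous fun e => |pull τ e basisE|)
    (h0 : ∀ e, pull τ e basisE ≠ 0) : 0 < formMeasure basisE τ Set.univ := by
  obtain ⟨c, hc, he⟩ := exists_mem_target 0
  have h : chartMeasure basisE τ c ≤ formMeasure basisE τ :=
    le_iSup₂ (f := fun c (_ : c ∈ atlas E N) => chartMeasure basisE τ c) c hc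
  refine lt_of_lt_of_le ?_ (h Set.univ)
  rw [chartMeasure_apply τ hc MeasurableSet.univ, Set.preimage_univ, Set.univ_inter,
    lintegral_pos_iff_support hτ.measurable.ennreal_ofReal]
  have hsupp : Function.support (fun e => ENNReal.ofReal |pull τ e basisE|) = Set.univ :=
    Set.eq_univ_of_forall fun e => by simpa using h0 e
  rw [hsupp, Measure.restrict_apply_univ]
  exact c.open_target.measure_pos _ ⟨0, he⟩

/-! ### Regularity of the volume density of an arbitrary smooth `G₂` form. -/

theorem smulWedge_comp {V W : Type*} [AddCommGroup V] [Module ℝ V] [TopologicalSpace V]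
    [AddCommGroup W] [Module ℝ W] [TopologicalSpace W] {k : ℕ} (r : ℝ) (θ : Fin k → V →L[ℝ] ℝ)
    (L : W →L[ℝ] V) : (smulWedge r θ).compContinuousLinearMap L =
      smulWedge r fun i => θ i ∘L L := by
  rw [smulWedge, smulWedge, ← wedge_comp]
  rfl

theorem g2Model_comp {V W : Type*} [AddCommGroup V] [Module ℝ V] [TopologicalSpace V]
    [AddCommGroup W] [Module ℝ W] [TopologicalSpace W] (θ : Fin 7 → V →L[ℝ] ℝ)
    (L : W →L[ℝ] V) : (g2Model θ).compContinuousLinearMap L = g2Model fun i => θ i ∘L L := by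
  ext v
  simp [g2Model, wedge_apply, Matrix.det_fin_three]

theorem pull_orient (p : Params) (e : E) : pull (orient p) e = smulWedge (p.α * p.β)
    ![dx1, dy1, dt, Complex.reCLM ∘L coverTheta2 e, Complex.imCLM ∘L coverTheta2 e,
      Complex.reCLM ∘L coverTheta3 e, Complex.imCLM ∘L coverTheta3 e] := by
  set D : E →L[ℝ] TangentSpace 𝓘(ℝ, E) (proj e) := mfderiv 𝓘(ℝ, E) 𝓘(ℝ, E) proj e with hD
  rw [pull, orient_apply]
  refine (smulWedge_comp _ _ D).trans (congrArg (smulWedge (p.α * p.β)) ?_)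
  funext i
  rw [← g1_proj e, ← g2_proj e, ← g3_proj e, ← Theta2_proj e, ← Theta3_proj e]
  fin_cases i <;> rfl

/-- The frame of the covering dual to `(g¹, g², g³, Re Θ², Im Θ², Re Θ³, Im Θ³)`. -/
def dualFrame (e : E) : Fin 7 → E :=
  ![((1, 0, 0), 0), ((Complex.I, 0, 0), 0), ((0, 0, 0), 1),
    ((0, Complex.exp (-e.1.1), 0), 0), ((0, Complex.exp (-e.1.1) * Complex.I, 0), 0),
    ((0, 0, Complex.exp e.1.1), 0), ((0, 0, Complex.exp e.1.1 * Complex.I), 0)]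

theorem pull_orient_dualFrame (p : Params) (e : E) :
    pull (orient p) e (dualFrame e) = p.α * p.β := by
  rw [pull_orient, smulWedge, ContinuousAlternatingMap.smul_apply, wedge_apply]
  have h : Complex.exp e.1.1 * Complex.exp (-e.1.1) = 1 := by
    rw [← Complex.exp_add, add_neg_cancel, Complex.exp_zero]
  have h' : Complex.exp (-e.1.1) * Complex.exp e.1.1 = 1 := by rw [mul_comm, h]
  refine (congrArg _ ((congrArg Matrix.det ?_).trans Matrix.det_one)).trans (mul_one _)
  ext i j
  fin_cases i <;> fin_cases j <;>
    simp [dualFrame, dx1, dy1, dt, coverTheta2, coverTheta3, dw1, dw2, dw3, h, h', ← mul_assoc,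
      -Complex.mul_re, -Complex.mul_im]

theorem map_basis_ne_zero {V : Type*} [AddCommGroup V] [Module ℝ V] [TopologicalSpace V] {k : ℕ}
    (b : Module.Basis (Fin k) ℝ V) (A : V [⋀^Fin k]→L[ℝ] ℝ) {v : Fin k → V} (h : A v ≠ 0) :
    A b ≠ 0 :=
  (AlternatingMap.map_basis_ne_zero_iff b A.toAlternatingMap).2
    fun h0 => h (DFunLike.congr_fun h0 v)

theorem pull_orient_basisE_ne_zero (p : Params) (e : E) : pull (orient p) e basisE ≠ 0 := by
  obtain ⟨A, hA⟩ : ∃ A, A = pull (orient p) e := ⟨_, rfl⟩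
  have h : A (dualFrame e) ≠ 0 := by
    rw [hA, pull_orient_dualFrame]
    exact mul_ne_zero p.1.ne_zero p.2.1.ne_zero
  rw [← hA]
  exact map_basis_ne_zero basisE A h

theorem pull_volForm {ν : Form E N 7} (hν : ∀ e, pull ν e basisE ≠ 0) {φ : Form E N 3}
    (hφ : ∀ x, IsG2 (ν x) (φ x)) (e : E) : pull (volForm ν φ) e basisE ≠ 0 ∧
      |pull (volForm ν φ) e basisE| ^ 9 = (hitchinGram (pull φ e) basisE).det := by
  obtain ⟨θ, h⟩ := hφ (proj e)
  obtain ⟨⟨r, hr, hw⟩, hm⟩ := id h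
  have h1 : volForm ν φ (proj e) = wedge θ := g2Vol_eq h
  set D : E →L[ℝ] TangentSpace 𝓘(ℝ, E) (proj e) := mfderiv 𝓘(ℝ, E) 𝓘(ℝ, E) proj e with hD
  have h2 : pull (volForm ν φ) e = wedge fun i => θ i ∘L D := by
    rw [pull, h1]
    exact wedge_comp θ D
  have h3 : pull φ e = g2Model fun i => θ i ∘L D := by
    rw [pull, hm]
    exact g2Model_comp θ D
  have h4 : pull (volForm ν φ) e basisE = r * pull ν e basisE := by
    rw [pull, h1, hw]
    rfl
  have h5 : pull (volForm ν φ) e basisE ≠ 0 := by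
    rw [h4]
    exact mul_ne_zero hr.ne' (hν e)
  refine ⟨h5, ?_⟩
  rw [h2] at h5 ⊢
  rw [h3, det_hitchinGram _ _ h5]

theorem continuous_det_hitchinGram {X V : Type*} [TopologicalSpace X] [NormedAddCommGroup V]
    [NormedSpace ℝ V] {φ : X → V [⋀^Fin 3]→L[ℝ] ℝ} (hφ : Continuous φ) (b : Fin 7 → V) :
    Continuous fun x => (hitchinGram (φ x) b).det := by
  have hquad (u : Fin 7 → ℝ) : Continuous fun x => hitchinQuad (φ x) b u := by
    refine Continuous.div_const (Continuous.sqrt (Continuous.abs (Continuous.matrix_det ?_))) _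
    refine Continuous.add (continuous_matrix fun i j => ?_) continuous_const
    exact (ContinuousAlternatingMap.apply ℝ V ℝ ![∑ a, u a • b a, b i, b j]).continuous.comp hφ
  exact Continuous.matrix_det (continuous_matrix fun i j =>
    (((hquad _).sub (hquad _)).sub (hquad _)).div_const _)

/-- The coframes chosen pointwise need not vary continuously, but the density is the ninth root of
the Gram determinant, which is continuous in the form. -/
theorem continuous_abs_pull_volForm {ν : Form E N 7} (hν : ∀ e, pull ν e basisE ≠ 0)
    {φ : Form E N 3} (hs : IsSmooth φ) (hφ : ∀ x, IsG2 (ν x) (φ x)) :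
    Continuous fun e => |pull (volForm ν φ) e basisE| := by
  have h (e : E) : |pull (volForm ν φ) e basisE| =
      (hitchinGram (pull φ e) basisE).det ^ (((9 : ℕ) : ℝ)⁻¹) := by
    rw [← (pull_volForm hν hφ e).2, Real.pow_rpow_inv_natCast (abs_nonneg _) (by norm_num)]
  simp_rw [h]
  exact (continuous_det_hitchinGram (isSmooth_iff_contDiff_pull.1 hs).continuous _).rpow_const
    fun _ => Or.inr (by positivity)

theorem hitchinN_pos_lt_top (p : Params) {ψ : closedForms E N 3}
    (hψ : ∀ x, IsG2 (orient p x) (ψ.1 x)) :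
    0 < hitchinN (orient p) ψ ∧ hitchinN (orient p) ψ < ⊤ := by
  have hν := pull_orient_basisE_ne_zero p
  have hc := continuous_abs_pull_volForm hν ψ.2.1 hψ
  exact ⟨formMeasure_univ_pos hc fun e => (pull_volForm hν hψ e).1, formMeasure_univ_lt_top hc⟩

/-! ### Membership in the class and unboundedness of the Hitchin functional. -/

theorem phiScaled_mem_plusClass (p : Params) {μ : ℝ} (hμ : 0 < μ) :
    (⟨phiScaled p μ, phiScaled_mem_closedForms p μ⟩ : closedForms E N 3) ∈
      plusClass (orient p) (deRhamClass ⟨phi p, phi_mem_closedForms p⟩) :=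
  ⟨(deRhamClass_eq_iff _ _).2 (phiScaled_sub_phi_mem_exactForms p μ), isG2_phiScaled p hμ⟩

theorem phi_mem_plusClass (p : Params) :
    (⟨phi p, phi_mem_closedForms p⟩ : closedForms E N 3) ∈
      plusClass (orient p) (deRhamClass ⟨phi p, phi_mem_closedForms p⟩) :=
  ⟨rfl, fun x => by simpa only [phiScaled_one] using isG2_phiScaled p one_pos x⟩

theorem not_bddAbove_hitchinN (p : Params) :
    ¬ BddAbove ((fun ψ => (hitchinN (orient p) ψ).toReal) ''
      plusClass (orient p) (deRhamClass ⟨phi p, phi_mem_closedForms p⟩)) := by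
  rintro ⟨B, hB⟩
  obtain ⟨h0, htop⟩ := hitchinN_pos_lt_top p (phi_mem_plusClass p).2
  set h := (hitchinN (orient p) ⟨phi p, phi_mem_closedForms p⟩).toReal with hh
  have hpos : 0 < h := ENNReal.toReal_pos h0.ne' htop.ne
  -- Since `μ ≥ 1`, the scaling factor satisfies `μ⁴ ≥ μ > B / h`, contradicting the bound `B`.
  set μ := max 1 (B / h + 1)
  have hμ : 1 ≤ μ := le_max_left _ _
  have h1 := hB ⟨_, phiScaled_mem_plusClass p (zero_lt_one.trans_le hμ), rfl⟩
  have h2 : hitchinN (orient p) ⟨phiScaled p μ, phiScaled_mem_closedForms p μ⟩ =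
      ENNReal.ofReal (μ ^ 4) * hitchinN (orient p) ⟨phi p, phi_mem_closedForms p⟩ :=
    hitchin_phiScaled p (zero_lt_one.trans_le hμ)
  simp only [h2, ENNReal.toReal_mul, ENNReal.toReal_ofReal (by positivity : 0 ≤ μ ^ 4)] at h1
  rw [← hh, ← le_div_iff₀ hpos] at h1
  have h3 : μ ≤ μ ^ 4 := le_self_pow₀ hμ (by norm_num)
  have h4 : B / h + 1 ≤ μ := le_max_right _ _
  linarith

end HitchinNakamura

end

open HitchinNakamura in
theorem theorem1p1 :
    ∃ hcl : ∀ p : Params, phi p ∈ closedForms E N 3,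
      Function.Injective (fun p : Params => deRhamClass ⟨phi p, hcl p⟩) ∧
      ∀ p : Params,
        (⟨phi p, hcl p⟩ : closedForms E N 3) ∈
          plusClass (orient p) (deRhamClass ⟨phi p, hcl p⟩) ∧
        (∀ ψ ∈ plusClass (orient p) (deRhamClass ⟨phi p, hcl p⟩),
          0 < hitchinN (orient p) ψ ∧ hitchinN (orient p) ψ < ⊤) ∧
        (∀ μ : ℝ, 1 ≤ μ → ∃ ψ ∈ plusClass (orient p) (deRhamClass ⟨phi p, hcl p⟩),
          ψ.1 = phiScaled p μ ∧
          hitchinN (orient p) ψ =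
            ENNReal.ofReal (μ ^ 4) * hitchinN (orient p) ⟨phi p, hcl p⟩) ∧
        ¬ BddAbove ((fun ψ => (hitchinN (orient p) ψ).toReal) ''
          plusClass (orient p) (deRhamClass ⟨phi p, hcl p⟩)) :=
  ⟨phi_mem_closedForms, fun _ _ h => params_eq ((deRhamClass_eq_iff _ _).1 h), fun p =>
    ⟨phi_mem_plusClass p, fun _ hψ => hitchinN_pos_lt_top p hψ.2,
      fun μ hμ => ⟨⟨phiScaled p μ, phiScaled_mem_closedForms p μ⟩,
        phiScaled_mem_plusClass p (zero_lt_one.trans_le hμ), rfl,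
        hitchin_phiScaled p (zero_lt_one.trans_le hμ)⟩,
      not_bddAbove_hitchinN p⟩⟩
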